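/- **Setting.** Let $(X,\{S_i\}_{i\in\mathcal S})$ be a stratified space: $X$ is Hausdorff and paracompact and is the union of a locally finite family of disjoint, locally closed smooth manifolds $S_i$ (the strata) of bounded dimension, indexed by a partially ordered set, with $S_i\cap\overline{S_j}\neq\emptyset\iff S_i\subset\overline{S_j}\iff i\le j$; and (recursively) every point $x$ of a stratum $S$ has an open neighbourhood $U(x)$ with a homeomorphism $\phi_x\colon U(x)\to B\times cL(1)$, $x\mapsto(0,\text{vertex})$, that maps strata diffeomorphically onto strata, where $B$ is an open ball of dimension $\dim S$, the link $L$ is a compact stratified space, and $cL(1)=L\times[0,1)/L\times\{0\}$ is the open cone. Assume that the union $X^{reg}$ of the open strata is connected, and that the largest dimension of a stratum is $2n$. Let $C^\infty(X)$ be a smooth structure on $X$: the ring of global sections of a sheaf $SC^\infty$ of continuous real functions whose sections are closed under composition with $C^\infty$ functions of finitely many variables, such that (i) every smooth function with compact support in $X^{reg}$, extended by zero, lies in $C^\infty(X)$, and (ii) near each point there is a trivialization $\phi_x$ as above that identifies $SC^\infty$ with a product smooth structure on $B\times cL(1)$, i.e. the one generated by the smooth functions on $B$ and a smooth structure on $cL(1)$.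 Here (recursively) $L$ carries a smooth structure, and a smooth structure on $cL(1)$ is a sheaf of the same kind whose global sections restrict to sections of the product smooth structure on $L\times(0,1)$, and which contains the extensions by zero of the compactly supported sections of the latter. Let $T_x^*X=\mathfrak m_x/\mathfrak m_x^2$, where $\mathfrak m_x$ is the ideal of germs at $x$ of smooth functions vanishing at $x$, and let $d_xf\in T^*_xX$ be the class of $f-f(x)$. A smooth $k$-form is a section of $\Lambda^kT^*X$ that near each point is a finite sum $\sum f_0\,df_1\wedge\dots\wedge df_k$ with $f_0,\dots,f_k\in C^\infty(X)$. Let $\Omega^k(X)$ be the space of these forms. For a point $x$ of a stratum $S$, a form at $x$ restricts to $T_xS$ by $d_xf\mapsto d_x(f|_S)$. Let $\omega=\{\omega_i\}$ be a stratified symplectic form on $X$, i.e. a symplectic form $\omega_i$ on each stratum $S_i$. Assume that $C^\infty(X)$ is Poisson: there is a Poisson bracket on the algebra $C^\infty(X)$ with $\{f,g\}|_{S_i}=\{f|_{S_i},g|_{S_i}\}_{\omega_i}$ for all $f,g\in C^\infty(X)$ and all $i$. Assume also that $C^\infty(X)$ is compatible with $\omega$: there is $\tilde\omega\in\Omega^2(X)$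 that restricts to $\omega_i$ on each $S_i$. Let $L\alpha=\tilde\omega\wedge\alpha$, and for $0\le k\le n$ let $$\mathcal P_{n-k}(X)=\{\alpha\in\Omega^{n-k}(X)\;:\;L^{k+1}\alpha=0\}$$ be the space of primitive forms of degree $n-k$. **Proposition.** For every $0\le k\le n$, $$\Omega^{n-k}(X)=\bigoplus_{r\ge0,\;k+2r\le n}L^r\bigl(\mathcal P_{n-k-2r}(X)\bigr)=\mathcal P_{n-k}(X)\oplus L\bigl(\mathcal P_{n-k-2}(X)\bigr)\oplus\cdots,$$ and for every $k\ge0$, $$\Omega^{n+k}(X)=\bigoplus_{r\ge0,\;k+2r\le n}L^{k+r}\bigl(\mathcal P_{n-k-2r}(X)\bigr)=L^k\bigl(\mathcal P_{n-k}(X)\bigr)\oplus L^{k+1}\bigl(\mathcal P_{n-k-2}(X)\bigr)\oplus\cdots$$ (internal direct sums of real vector spaces; for $k>n$ the second sum is empty and $\Omega^{n+k}(X)=0$). -/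

import Mathlib

open scoped Manifold ContDiff Topology

universe u

noncomputable section

namespace StratifiedSymplectic

/-! ### Sheaves of continuous functions that are closed under smooth operations -/

/-- A sheaf of germs of continuous real functions on `X` whose sections form `C^∞`-rings.
`SmoothAt x f` says that the germ of `f` at `x` belongs to the stalk at `x`; the sections over an
open set `U` are the functions on `U` all of whose germs belong to the stalks. This is the étalé
description of a subsheaf of the sheaf of continuous functions: `eventually` says that a germ in
the stalk at `x` is the germ of a section over a neighbourhood of `x`. -/
structure CInfSheaf (X : Type u) [TopologicalSpace X] where
  SmoothAt : X → (X → ℝ) → Prop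
  congr : ∀ {x : X} {f g : X → ℝ}, f =ᶠ[𝓝 x] g → SmoothAt x f → SmoothAt x g
  eventually : ∀ {x : X} {f : X → ℝ}, SmoothAt x f → ∀ᶠ y in 𝓝 x, SmoothAt y f
  continuousAt : ∀ {x : X} {f : X → ℝ}, SmoothAt x f → ContinuousAt f x
  comp : ∀ {x : X} (m : ℕ) (G : (Fin m → ℝ) → ℝ) (f : Fin m → X → ℝ), ContDiff ℝ ∞ G →
    (∀ i, SmoothAt x (f i)) → SmoothAt x (fun y => G fun i => f i y)

namespace CInfSheaf

variable {X : Type u} [TopologicalSpace X] (F : CInfSheaf X)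

theorem const (x : X) (c : ℝ) : F.SmoothAt x (fun _ => c) :=
  F.comp 0 (fun _ => c) (fun i => i.elim0) contDiff_const (fun i => i.elim0)

theorem add {x : X} {f g : X → ℝ} (hf : F.SmoothAt x f) (hg : F.SmoothAt x g) :
    F.SmoothAt x (f + g) :=
  F.comp (x := x) 2 (fun v => v 0 + v 1) ![f, g] (by fun_prop)
    (fun i => by fin_cases i <;> assumption)

theorem mul {x : X} {f g : X → ℝ} (hf : F.SmoothAt x f) (hg : F.SmoothAt x g) :
    F.SmoothAt x (f * g) :=
  F.comp (x := x) 2 (fun v => v 0 * v 1) ![f, g] (by fun_prop)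
    (fun i => by fin_cases i <;> assumption)

/-- The algebra `C^∞(X)` of global sections. -/
def global : Subalgebra ℝ (X → ℝ) where
  carrier := {f | ∀ x, F.SmoothAt x f}
  mul_mem' hf hg x := F.mul (hf x) (hg x)
  add_mem' hf hg x := F.add (hf x) (hg x)
  algebraMap_mem' c x := F.const x c

/-- The functions that are smooth near `x`. -/
def functionsAt (x : X) : Subalgebra ℝ (X → ℝ) where
  carrier := {f | F.SmoothAt x f}
  mul_mem' hf hg := F.mul hf hg
  add_mem' hf hg := F.add hf hg
  algebraMap_mem' c := F.const x c

/-- The functions in `functionsAt x` whose germ at `x` is zero. -/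
def nullAt (x : X) : Ideal (F.functionsAt x) where
  carrier := {f | (f : X → ℝ) =ᶠ[𝓝 x] 0}
  add_mem' hf hg := by
    filter_upwards [hf, hg] with y hy hy'
    simp [hy, hy']
  zero_mem' := Filter.EventuallyEq.rfl
  smul_mem' c f hf := by
    filter_upwards [hf] with y hy
    simp [hy]

/-- The ring `C^∞_x(X)` of germs at `x` of smooth functions. -/
def Stalk (x : X) : Type u := F.functionsAt x ⧸ F.nullAt x

instance (x : X) : CommRing (F.Stalk x) :=
  inferInstanceAs (CommRing (F.functionsAt x ⧸ F.nullAt x))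

instance (x : X) : Algebra ℝ (F.Stalk x) :=
  inferInstanceAs (Algebra ℝ (F.functionsAt x ⧸ F.nullAt x))

/-- The germ at `x` of a function that is smooth near `x`. -/
def germ (x : X) : F.functionsAt x →ₐ[ℝ] F.Stalk x := Ideal.Quotient.mkₐ ℝ (F.nullAt x)

/-- Evaluation of germs at `x`. -/
def evalAt (x : X) : F.Stalk x →ₐ[ℝ] ℝ :=
  Ideal.Quotient.liftₐ (F.nullAt x) ((Pi.evalAlgHom ℝ (fun _ : X => ℝ) x).comp
    (F.functionsAt x).val) (fun _ hf => Filter.EventuallyEq.eq_of_nhds hf)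

theorem evalAt_germ (x : X) (f : F.functionsAt x) : F.evalAt x (F.germ x f) = (f : X → ℝ) x := rfl

/-- The ideal `𝔪_x` of germs vanishing at `x`. -/
def maxIdeal (x : X) : Ideal (F.Stalk x) := RingHom.ker (F.evalAt x)

/-- The cotangent space `T*_x X = 𝔪_x / 𝔪_x²`. -/
abbrev Cotangent (x : X) : Type u := (F.maxIdeal x).Cotangent

/-- The differential `d_x f`: the class of `f - f(x)` in `𝔪_x / 𝔪_x²`. -/
def differentialAt (x : X) (f : F.functionsAt x) : F.Cotangent x :=
  (F.maxIdeal x).toCotangent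
    ⟨F.germ x f - algebraMap ℝ (F.Stalk x) ((f : X → ℝ) x), by
      simp [maxIdeal, RingHom.mem_ker, evalAt_germ]⟩

/-- The differential at `x` of a global smooth function. -/
def d (f : F.global) (x : X) : F.Cotangent x :=
  F.differentialAt x ⟨(f : X → ℝ), f.2 x⟩

/-- All sections `x ↦ α x ∈ ⨁_k Λ^k T*_x X`, with no smoothness, and with the pointwise wedge
product as multiplication. -/
abbrev Sections : Type u := ∀ x : X, ExteriorAlgebra ℝ (F.Cotangent x)

/-- The smooth differential `k`-forms: sections of `Λ^k T*X` that near every point are finite sums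
`∑ f₀ df₁ ∧ … ∧ df_k` with `f₀, …, f_k ∈ C^∞(X)`. -/
def IsSmoothForm (k : ℕ) (α : F.Sections) : Prop :=
  ∀ x : X, ∃ U : Set X, IsOpen U ∧ x ∈ U ∧
    ∃ (N : ℕ) (f₀ : Fin N → F.global) (f : Fin N → Fin k → F.global), ∀ y ∈ U,
      α y = ∑ a, ((f₀ a : X → ℝ) y) • ExteriorAlgebra.ιMulti ℝ k (fun b => F.d (f a b) y)

/-- The space `Ω^k(X)`. -/
def Forms (k : ℕ) : Submodule ℝ F.Sections where
  carrier := {α | F.IsSmoothForm k α}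
  zero_mem' x := ⟨Set.univ, isOpen_univ, trivial, 0, Fin.elim0, Fin.elim0, fun y _ => by simp⟩
  add_mem' {α β} hα hβ x := by
    obtain ⟨U, hU, hxU, N, f₀, f, hf⟩ := hα x
    obtain ⟨V, hV, hxV, M, g₀, g, hg⟩ := hβ x
    refine ⟨U ∩ V, hU.inter hV, ⟨hxU, hxV⟩, N + M, Fin.append f₀ g₀, Fin.append f g, ?_⟩
    intro y hy
    simp [Fin.sum_univ_add, hf y hy.1, hg y hy.2]
  smul_mem' c α hα x := by
    obtain ⟨U, hU, hxU, N, f₀, f, hf⟩ := hα x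
    refine ⟨U, hU, hxU, N, fun a => c • f₀ a, f, fun y hy => ?_⟩
    simp [hf y hy, Finset.smul_sum, smul_smul]

/-- The operator `L`: wedge multiplication by the form `w`. -/
def L (w : F.Sections) : Module.End ℝ F.Sections := LinearMap.mulLeft ℝ w

/-- `𝒫_{n-k}`, the primitive forms of degree `n - k` with respect to the 2-form `w`:
those `α ∈ Ω^{n-k}(X)` with `L^{k+1} α = 0`. It is only used for `k ≤ n`. -/
def Primitive (w : F.Sections) (n k : ℕ) : Submodule ℝ F.Sections :=
  F.Forms (n - k) ⊓ LinearMap.ker (F.L w ^ (k + 1))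

/-- The sheaf of smooth functions of a manifold. -/
def ofManifold {E : Type*} [NormedAddCommGroup E] [NormedSpace ℝ E] {H : Type*}
    [TopologicalSpace H] (I : ModelWithCorners ℝ E H) (M : Type u) [TopologicalSpace M]
    [ChartedSpace H M] : CInfSheaf M where
  SmoothAt x f := ∀ᶠ y in 𝓝 x, ContMDiffAt I 𝓘(ℝ, ℝ) ∞ f y
  congr {x f g} h hf := by
    filter_upwards [h.eventuallyEq_nhds, hf] with y hy hfy
    exact hfy.congr_of_eventuallyEq hy.symm
  eventually h := h.eventually_nhds
  continuousAt h := h.self_of_nhds.continuousAt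
  comp {x} m G f hG hf := by
    filter_upwards [Filter.eventually_all.2 hf] with y hy
    have h : ContMDiffAt I 𝓘(ℝ, Fin m → ℝ) ∞ (fun z => fun i => f i z) y :=
      contMDiffAt_pi_space.2 hy
    exact hG.contMDiff.contMDiffAt.comp y h

/-- The germs on `Y × Z` generated, under smooth operations, by the pull-backs of the germs of
`A` and of `B` along the two projections. -/
inductive ProdSmoothAt {Y : Type*} {Z : Type*} [TopologicalSpace Y] [TopologicalSpace Z]
    (A : CInfSheaf Y) (B : CInfSheaf Z) (p : Y × Z) : (Y × Z → ℝ) → Prop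
  | fst (f : Y → ℝ) : A.SmoothAt p.1 f → ProdSmoothAt A B p (fun q => f q.1)
  | snd (f : Z → ℝ) : B.SmoothAt p.2 f → ProdSmoothAt A B p (fun q => f q.2)
  | comp (m : ℕ) (G : (Fin m → ℝ) → ℝ) (f : Fin m → Y × Z → ℝ) : ContDiff ℝ ∞ G →
      (∀ i, ProdSmoothAt A B p (f i)) → ProdSmoothAt A B p (fun q => G fun i => f i q)
  | congr (f g : Y × Z → ℝ) : f =ᶠ[𝓝 p] g → ProdSmoothAt A B p f → ProdSmoothAt A B p g

/-- The product smooth structure on `Y × Z`. -/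
def prod {Y : Type*} {Z : Type*} [TopologicalSpace Y] [TopologicalSpace Z]
    (A : CInfSheaf Y) (B : CInfSheaf Z) : CInfSheaf (Y × Z) where
  SmoothAt := ProdSmoothAt A B
  congr h hf := ProdSmoothAt.congr _ _ h hf
  eventually {p f} hf := by
    induction hf with
    | fst f h =>
      filter_upwards [(continuous_fst.tendsto p).eventually (A.eventually h)] with q hq
      exact .fst f hq
    | snd f h =>
      filter_upwards [(continuous_snd.tendsto p).eventually (B.eventually h)] with q hq
      exact .snd f hq
    | comp m G f hG _ ih =>
      filter_upwards [Filter.eventually_all.2 ih] with q hq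
      exact .comp m G f hG hq
    | congr f g h _ ih =>
      filter_upwards [ih, h.eventuallyEq_nhds] with q hq hq'
      exact .congr f g hq' hq
  continuousAt {p f} hf := by
    induction hf with
    | fst f h => exact (A.continuousAt h).comp continuousAt_fst
    | snd f h => exact (B.continuousAt h).comp continuousAt_snd
    | comp m G f hG _ ih =>
      exact hG.continuous.continuousAt.comp (continuousAt_pi.2 ih)
    | congr f g h _ ih => exact ih.congr h
  comp m G f hG hf := .comp m G f hG hf

end CInfSheaf

/-! ### Decomposed and stratified spaces -/

/-- A decomposition of `X` into manifolds: a locally finite family of disjoint locally closed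
manifolds, indexed by a partially ordered set, covering `X`, subject to the frontier condition, and
with bounded dimensions. -/
structure Decomposition (X : Type u) [TopologicalSpace X] where
  Idx : Type u
  [order : PartialOrder Idx]
  stratum : Idx → Set X
  dim : Idx → ℕ
  [charted : ∀ i, ChartedSpace (EuclideanSpace ℝ (Fin (dim i))) (stratum i)]
  [manifold : ∀ i, IsManifold (𝓡 (dim i)) ∞ (stratum i)]
  isLocallyClosed : ∀ i, IsLocallyClosed (stratum i)
  locallyFinite : LocallyFinite stratum
  disjoint : ∀ i j, i ≠ j → Disjoint (stratum i) (stratum j)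
  cover : ⋃ i, stratum i = Set.univ
  frontier_iff : ∀ i j,
    (stratum i ∩ closure (stratum j)).Nonempty ↔ stratum i ⊆ closure (stratum j)
  frontier_iff_le : ∀ i j, stratum i ⊆ closure (stratum j) ↔ i ≤ j
  dim_bounded : ∃ N, ∀ i, dim i ≤ N

attribute [instance] Decomposition.order Decomposition.charted Decomposition.manifold

/-- The open unit ball of `ℝ^d`. -/
abbrev unitBall (d : ℕ) : TopologicalSpace.Opens (EuclideanSpace ℝ (Fin d)) :=
  ⟨Metric.ball 0 1, Metric.isOpen_ball⟩

/-- The open interval `(0, 1)`. -/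
abbrev openInterval : TopologicalSpace.Opens ℝ := ⟨Set.Ioo 0 1, isOpen_Ioo⟩

/-- The centre of the unit ball. -/
def unitBall.center (d : ℕ) : unitBall d := ⟨0, by simp [unitBall]⟩

/-- The identification of `L × {0}` with the vertex. -/
inductive ConeRel (L : Type u) : Unit ⊕ (L × Set.Ico (0 : ℝ) 1) → Unit ⊕ (L × Set.Ico (0 : ℝ) 1) →
    Prop
  | glue (l : L) : ConeRel L (Sum.inr (l, ⟨0, by simp⟩)) (Sum.inl ())

/-- The open cone `cL(1) = L × [0,1) / L × {0}`, with the quotient topology; the vertex is present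
also when `L` is empty. -/
def Cone (L : Type u) : Type u := Quot (ConeRel L)

instance (L : Type u) [TopologicalSpace L] : TopologicalSpace (Cone L) :=
  inferInstanceAs (TopologicalSpace (Quot (ConeRel L)))

/-- The vertex of the cone. -/
def Cone.vertex (L : Type u) : Cone L := Quot.mk _ (Sum.inl ())

/-- The inclusion of `L × (0, 1)` into the cone. -/
def Cone.incl (L : Type u) (p : L × openInterval) : Cone L :=
  Quot.mk _ (Sum.inr (p.1, ⟨p.2, p.2.2.1.le, p.2.2.2⟩))

namespace Decomposition

variable {X : Type u} [TopologicalSpace X] (D : Decomposition X)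

/-- The part of a stratum in an open set `U`, as an open subset of the stratum. -/
def part (i : D.Idx) (U : TopologicalSpace.Opens X) : TopologicalSpace.Opens (D.stratum i) :=
  TopologicalSpace.Opens.comap ⟨Subtype.val, continuous_subtype_val⟩ U

/-- A point of `D.part i U`, as a point of `U`. -/
def partToOpen (i : D.Idx) (U : TopologicalSpace.Opens X) (y : D.part i U) : U := ⟨y.1.1, y.2⟩

/-- The regular part `X^reg`: the union of the open strata. -/
def regular : Set X := ⋃ i ∈ {i | IsOpen (D.stratum i)}, D.stratum i

/-- `n` is the dimension of `X`: the largest dimension of a stratum. -/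
def HasDim (n : ℕ) : Prop := IsGreatest (Set.range D.dim) n

/-- A stratified diffeomorphism from an open neighbourhood `U` of the point `x` of the `i`-th
stratum onto `B × cL(1)`, where `B` is a ball of dimension that of the stratum and the strata of
`B × cL(1)` are `B × {vertex}` and the `B × (S × (0,1))` for `S` a stratum of `L`. -/
structure LocalTrivialization (i : D.Idx) (x : D.stratum i) (L : Type u) [TopologicalSpace L]
    (DL : Decomposition L) where
  U : TopologicalSpace.Opens X
  mem : (x : X) ∈ U
  toHomeo : U ≃ₜ unitBall (D.dim i) × Cone L
  map_base : toHomeo ⟨x, mem⟩ = (unitBall.center _, Cone.vertex L)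
  vertex_stratum : ∃ Φ : D.part i U ≃ₘ^∞⟮𝓡 (D.dim i), 𝓡 (D.dim i)⟯ unitBall (D.dim i),
    ∀ y, toHomeo (D.partToOpen i U y) = (Φ y, Cone.vertex L)
  other_stratum : ∀ k, k ≠ i → (D.stratum k ∩ U).Nonempty → ∃ (j : DL.Idx)
    (Φ : D.part k U ≃ₘ^∞⟮𝓡 (D.dim k), (𝓡 (D.dim i)).prod ((𝓡 (DL.dim j)).prod 𝓘(ℝ, ℝ))⟯
      (unitBall (D.dim i) × (DL.stratum j × openInterval))),
    ∀ y, toHomeo (D.partToOpen k U y) =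
      ((Φ y).1, Cone.incl L ((Φ y).2.1.1, (Φ y).2.2))

/-- The decomposed space is a stratified space: every point has a neighbourhood that is
stratified-diffeomorphic to `B × cL(1)` with a compact stratified space `L` (the link). -/
inductive IsStratified : {X : Type u} → [TopologicalSpace X] → Decomposition X → Prop
  | intro {X : Type u} [TopologicalSpace X] (D : Decomposition X)
      (L : ∀ i, D.stratum i → Type u) [∀ i x, TopologicalSpace (L i x)]
      [∀ i x, CompactSpace (L i x)] [∀ i x, T2Space (L i x)]
      (DL : ∀ i x, Decomposition (L i x))
      (stratified : ∀ i x, IsStratified (DL i x))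
      (trivialization : ∀ i x, Nonempty (D.LocalTrivialization i x (L i x) (DL i x))) :
      IsStratified D

/-- `f` is the extension by zero `j_* f₀` of some `f₀ ∈ C^∞_0(X^reg)`. -/
def IsRegularBump (f : X → ℝ) : Prop :=
  IsCompact (tsupport f) ∧ tsupport f ⊆ D.regular ∧
    ∀ i, IsOpen (D.stratum i) →
      ContMDiff (𝓡 (D.dim i)) 𝓘(ℝ, ℝ) ∞ (fun y : D.stratum i => f y)

end Decomposition

/-- The sheaf `C` on the cone is a smooth structure on `cL(1)`, given the smooth structure `F` on
the link: sections restrict to sections of the product smooth structure on `L × (0,1)`, and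
sections of the latter with compact support extend by zero. -/
def IsConeStructure {L : Type u} [TopologicalSpace L] (F : CInfSheaf L) (C : CInfSheaf (Cone L)) :
    Prop :=
  (∀ f ∈ C.global, (fun p => f (Cone.incl L p)) ∈
      (F.prod (CInfSheaf.ofManifold 𝓘(ℝ, ℝ) openInterval)).global) ∧
    ∀ f ∈ (F.prod (CInfSheaf.ofManifold 𝓘(ℝ, ℝ) openInterval)).global, HasCompactSupport f →
      ∀ g : Cone L → ℝ, g (Cone.vertex L) = 0 → (∀ p, g (Cone.incl L p) = f p) → g ∈ C.global

/-- The sheaf `F` is a smooth structure on the stratified space `(X, D)`: it contains the smooth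
functions with compact support in the regular part, and near each point a local trivialization
identifies it with a product smooth structure on `B × cL(1)`, where `cL(1)` carries a smooth
structure associated with a smooth structure of the link. -/
inductive IsSmoothStructure :
    {X : Type u} → [TopologicalSpace X] → Decomposition X → CInfSheaf X → Prop
  | intro {X : Type u} [TopologicalSpace X] (D : Decomposition X) (F : CInfSheaf X)
      (bump : ∀ f, D.IsRegularBump f → f ∈ F.global)
      (L : ∀ i, D.stratum i → Type u) [∀ i x, TopologicalSpace (L i x)]
      [∀ i x, CompactSpace (L i x)] [∀ i x, T2Space (L i x)]
      (DL : ∀ i x, Decomposition (L i x)) (FL : ∀ i x, CInfSheaf (L i x))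
      (C : ∀ i x, CInfSheaf (Cone (L i x)))
      (stratified : ∀ i x, (DL i x).IsStratified)
      (link : ∀ i x, IsSmoothStructure (DL i x) (FL i x))
      (cone : ∀ i x, IsConeStructure (FL i x) (C i x))
      (T : ∀ i x, D.LocalTrivialization i x (L i x) (DL i x))
      (compat : ∀ i x (y : (T i x).U) (f : X → ℝ), F.SmoothAt y f ↔
        ((CInfSheaf.ofManifold (𝓡 (D.dim i)) (unitBall (D.dim i))).prod (C i x)).SmoothAt
          ((T i x).toHomeo y) (fun q => f ((T i x).toHomeo.symm q))) :
      IsSmoothStructure D F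

/-- Near a point of `B × {pt}` a germ of a product structure restricts to a smooth function on
`B`. -/
theorem prodSmoothAt_slice {E : Type*} [NormedAddCommGroup E] [NormedSpace ℝ E] {H : Type*}
    [TopologicalSpace H] {I : ModelWithCorners ℝ E H} {M Z : Type*} [TopologicalSpace M]
    [ChartedSpace H M] [TopologicalSpace Z] {B : CInfSheaf Z} {p : M × Z} {f : M × Z → ℝ}
    (hf : CInfSheaf.ProdSmoothAt (CInfSheaf.ofManifold I M) B p f) :
    (CInfSheaf.ofManifold I M).SmoothAt p.1 (fun b => f (b, p.2)) := by
  induction hf with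
  | fst f h => exact h
  | snd f h => exact (CInfSheaf.ofManifold I M).const p.1 (f p.2)
  | comp m G f hG _ ih => exact CInfSheaf.comp _ m G _ hG ih
  | congr f g h _ ih =>
    refine CInfSheaf.congr _ ?_ ih
    have hc : Filter.Tendsto (fun b : M => (b, p.2)) (𝓝 p.1) (𝓝 p) :=
      Continuous.tendsto (f := fun b : M => (b, p.2)) (by fun_prop) p.1
    exact hc.eventually h

/-- Germs of a smooth structure restrict to smooth germs on the strata. -/
theorem IsSmoothStructure.contMDiffAt {X : Type u} [TopologicalSpace X] {D : Decomposition X}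
    {F : CInfSheaf X} (hF : IsSmoothStructure D F) {i : D.Idx} (x : D.stratum i) {f : X → ℝ}
    (hf : F.SmoothAt x f) :
    ContMDiffAt (𝓡 (D.dim i)) 𝓘(ℝ, ℝ) ∞ (fun y : D.stratum i => f y) x := by
  obtain ⟨_, _, _, L, DL, FL, C, _, _, _, T, compat⟩ := hF
  have h1 := (compat i x ⟨x, (T i x).mem⟩ f).1 hf
  have h2 := (prodSmoothAt_slice h1).self_of_nhds
  obtain ⟨Φ, hΦ⟩ := (T i x).vertex_stratum
  let xp : D.part i (T i x).U := ⟨x, (T i x).mem⟩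
  have hx : (T i x).toHomeo ⟨x, (T i x).mem⟩ = (Φ xp, Cone.vertex (L i x)) := hΦ xp
  rw [hx] at h2
  have h3 := h2.comp xp (Φ.contMDiff_toFun.contMDiffAt)
  have h4 : ContMDiffAt (𝓡 (D.dim i)) 𝓘(ℝ, ℝ) ∞
      (fun y : D.part i (T i x).U => (fun z : D.stratum i => f z) y) xp := by
    refine h3.congr_of_eventuallyEq (Filter.Eventually.of_forall fun y => ?_)
    change f y = f ((T i x).toHomeo.symm (Φ y, Cone.vertex (L i x)))
    rw [← hΦ y, Homeomorph.symm_apply_apply]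
    rfl
  exact (contMDiffAt_subtype_iff (f := fun z : D.stratum i => f z)).1 h4

/-! ### Tangent vectors of strata as Zariski tangent vectors -/

section ZariskiTangent

variable {X : Type u} [TopologicalSpace X] {D : Decomposition X} {F : CInfSheaf X}
  (hF : IsSmoothStructure D F) {i : D.Idx} (x : D.stratum i)

/-- The derivative of smooth functions at `x` in the direction of a tangent vector `v` of the
stratum through `x`. -/
def derivFun (v : TangentSpace (𝓡 (D.dim i)) x) : F.functionsAt (x : X) →ₗ[ℝ] ℝ where
  toFun f := mvfderiv (𝓡 (D.dim i)) (fun y : D.stratum i => (f : X → ℝ) y) x v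
  map_add' f g := by
    have hf := (hF.contMDiffAt x f.2).mdifferentiableAt (by simp)
    have hg := (hF.contMDiffAt x g.2).mdifferentiableAt (by simp)
    exact DFunLike.congr_fun (mvfderiv_add hf hg) v
  map_smul' c f := by
    have hf := (hF.contMDiffAt x f.2).mdifferentiableAt (by simp)
    have h := DFunLike.congr_fun (mvfderiv_smul (I := 𝓡 (D.dim i)) (x := x)
      (a := fun _ : D.stratum i => c) mdifferentiableAt_const hf) v
    rw [mvfderiv_const] at h
    refine h.trans ?_
    simp

theorem derivFun_mul (v : TangentSpace (𝓡 (D.dim i)) x) (f g : F.functionsAt (x : X)) :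
    derivFun hF x v (f * g) =
      (f : X → ℝ) x * derivFun hF x v g + (g : X → ℝ) x * derivFun hF x v f := by
  have hf := (hF.contMDiffAt x f.2).mdifferentiableAt (by simp)
  have hg := (hF.contMDiffAt x g.2).mdifferentiableAt (by simp)
  exact DFunLike.congr_fun (mvfderiv_mul hf hg) v

/-- The derivative of germs of smooth functions at `x` in the direction of a tangent vector `v` of
the stratum through `x`. -/
def derivGerm (v : TangentSpace (𝓡 (D.dim i)) x) : F.Stalk (x : X) →ₗ[ℝ] ℝ :=
  Submodule.liftQ ((F.nullAt (x : X)).restrictScalars ℝ) (derivFun hF x v) (by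
    intro f hf
    have h : (fun y : D.stratum i => (f : X → ℝ) y) =ᶠ[𝓝 x] fun _ => 0 :=
      (continuous_subtype_val.tendsto x).eventually hf
    have h2 := h.mfderiv_eq (I := 𝓡 (D.dim i)) (I' := 𝓘(ℝ, ℝ))
    rw [mfderiv_const] at h2
    exact DFunLike.congr_fun h2 v)

theorem derivGerm_germ (v : TangentSpace (𝓡 (D.dim i)) x) (f : F.functionsAt (x : X)) :
    derivGerm hF x v (F.germ x f) =
      mvfderiv (𝓡 (D.dim i)) (fun y : D.stratum i => (f : X → ℝ) y) x v := rfl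

theorem derivGerm_mul (v : TangentSpace (𝓡 (D.dim i)) x) (a b : F.maxIdeal (x : X)) :
    derivGerm hF x v ((a : F.Stalk (x : X)) * b) = 0 := by
  obtain ⟨a, ha⟩ := a
  obtain ⟨b, hb⟩ := b
  obtain ⟨f, rfl⟩ : ∃ f, F.germ (x : X) f = a := Ideal.Quotient.mk_surjective a
  obtain ⟨g, rfl⟩ : ∃ g, F.germ (x : X) g = b := Ideal.Quotient.mk_surjective b
  have hf : (f : X → ℝ) x = 0 := ha
  have hg : (g : X → ℝ) x = 0 := hb
  change derivGerm hF x v (F.germ x f * F.germ x g) = 0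
  rw [← map_mul]
  change derivFun hF x v (f * g) = 0
  rw [derivFun_mul, hf, hg]
  simp

/-- The inclusion `T_x S → T^Z_x X = Hom(T*_x X, ℝ)` of the tangent space of the stratum `S`
through `x` into the Zariski tangent space: `v` is sent to `d_x f ↦ d(f|_S)(v)`. -/
def toZariski : TangentSpace (𝓡 (D.dim i)) x →ₗ[ℝ] Module.Dual ℝ (F.Cotangent (x : X)) where
  toFun v := Ideal.Cotangent.lift
    ((derivGerm hF x v).comp ((F.maxIdeal (x : X)).subtype.restrictScalars ℝ))
    (derivGerm_mul hF x v)
  map_add' v w := by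
    ext a
    obtain ⟨a, rfl⟩ := Ideal.toCotangent_surjective _ a
    obtain ⟨f, hf⟩ : ∃ f, F.germ (x : X) f = a := Ideal.Quotient.mk_surjective (a : F.Stalk (x : X))
    change derivGerm hF x (v + w) a = derivGerm hF x v a + derivGerm hF x w a
    rw [← hf, derivGerm_germ, derivGerm_germ, derivGerm_germ, map_add]
  map_smul' c v := by
    ext a
    obtain ⟨a, rfl⟩ := Ideal.toCotangent_surjective _ a
    obtain ⟨f, hf⟩ : ∃ f, F.germ (x : X) f = a := Ideal.Quotient.mk_surjective (a : F.Stalk (x : X))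
    change derivGerm hF x (c • v) a = c • derivGerm hF x v a
    rw [← hf, derivGerm_germ, derivGerm_germ, map_smul]

theorem toZariski_differentialAt (v : TangentSpace (𝓡 (D.dim i)) x) (f : F.functionsAt (x : X)) :
    toZariski hF x v (F.differentialAt x f) =
      mvfderiv (𝓡 (D.dim i)) (fun y : D.stratum i => (f : X → ℝ) y) x v := by
  have h : derivGerm hF x v (algebraMap ℝ (F.Stalk (x : X)) ((f : X → ℝ) x)) = 0 := by
    change mvfderiv (𝓡 (D.dim i)) (fun y : D.stratum i => (f : X → ℝ) x) x v = 0
    rw [mvfderiv_const]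
    rfl
  change derivGerm hF x v (F.germ x f - algebraMap ℝ (F.Stalk (x : X)) ((f : X → ℝ) x)) = _
  rw [map_sub, h, sub_zero, derivGerm_germ]

end ZariskiTangent

/-- The value `a(ξ, η)` of a 2-form `a ∈ Λ²V` on `ξ, η ∈ V*`: the double contraction, for which
`(u ∧ v)(ξ, η) = ξ(u) η(v) - ξ(v) η(u)`. -/
def evalTwo {V : Type*} [AddCommGroup V] [Module ℝ V] (a : ExteriorAlgebra ℝ V)
    (ξ η : Module.Dual ℝ V) : ℝ :=
  ExteriorAlgebra.algebraMapInv
    (CliffordAlgebra.contractLeft η (CliffordAlgebra.contractLeft ξ a))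

/-! ### Symplectic forms, compatibility and Poisson structures -/

section Symplectic

variable {d : ℕ} (M : Type u) [TopologicalSpace M] [ChartedSpace (EuclideanSpace ℝ (Fin d)) M]

/-- The expression of a field of alternating 2-forms in a chart. -/
def inChart {M} [TopologicalSpace M] [ChartedSpace (EuclideanSpace ℝ (Fin d)) M]
    (w : ∀ x : M, (TangentSpace (𝓡 d) x) [⋀^Fin 2]→L[ℝ] ℝ)
    (e : OpenPartialHomeomorph M (EuclideanSpace ℝ (Fin d))) (y : EuclideanSpace ℝ (Fin d)) :
    EuclideanSpace ℝ (Fin d) [⋀^Fin 2]→L[ℝ] ℝ :=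
  (w (e.symm y)).compContinuousLinearMap (mfderiv (𝓡 d) (𝓡 d) e.symm y)

/-- A symplectic form on the manifold `M`: a smooth, closed, nondegenerate 2-form. -/
structure SymplecticForm where
  form : ∀ x : M, (TangentSpace (𝓡 d) x) [⋀^Fin 2]→L[ℝ] ℝ
  smooth : ∀ e ∈ atlas (EuclideanSpace ℝ (Fin d)) M, ContDiffOn ℝ ∞ (inChart form e) e.target
  closed : ∀ e ∈ atlas (EuclideanSpace ℝ (Fin d)) M, ∀ y ∈ e.target,
    extDeriv (inChart form e) y = 0
  nondegenerate : ∀ x (v : TangentSpace (𝓡 d) x), (∀ w, form x ![v, w] = 0) → v = 0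

namespace SymplecticForm

variable {M} (w : SymplecticForm (d := d) M)

/-- `v ↦ ω(v, ·)`, as a map `T_x M → T*_x M`. -/
def flat (x : M) : TangentSpace (𝓡 d) x →ₗ[ℝ] Module.Dual ℝ (TangentSpace (𝓡 d) x) :=
  LinearMap.mk₂ ℝ (fun v u => w.form x ![v, u])
    (fun v v' u => by
      simpa using (w.form x).toAlternatingMap.map_vecCons_add ![u] v v')
    (fun c v u => by
      simpa using (w.form x).toAlternatingMap.map_vecCons_smul ![u] c v)
    (fun v u u' => by
      have h (z : TangentSpace (𝓡 d) x) : Function.update ![v, 0] 1 z = ![v, z] := by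
        ext i; fin_cases i <;> rfl
      have := (w.form x).toAlternatingMap.map_update_add ![v, 0] 1 u u'
      rwa [h, h, h] at this)
    (fun c v u => by
      have h (z : TangentSpace (𝓡 d) x) : Function.update ![v, 0] 1 z = ![v, z] := by
        ext i; fin_cases i <;> rfl
      have := (w.form x).toAlternatingMap.map_update_smul ![v, 0] 1 c u
      rwa [h, h] at this)

theorem flat_apply (x : M) (v u : TangentSpace (𝓡 d) x) : w.flat x v u = w.form x ![v, u] := rfl

instance (x : M) : FiniteDimensional ℝ (TangentSpace (𝓡 d) x) :=
  inferInstanceAs (FiniteDimensional ℝ (EuclideanSpace ℝ (Fin d)))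

theorem flat_injective (x : M) : Function.Injective (w.flat x) :=
  (injective_iff_map_eq_zero _).2 fun v hv =>
    w.nondegenerate x v fun u => LinearMap.congr_fun hv u

/-- The isomorphism `T_x M ≃ T*_x M` given by `ω`. Its inverse is the bivector `G_ω`, regarded as
a map `T*_x M → T_x M`. -/
def flatEquiv (x : M) : TangentSpace (𝓡 d) x ≃ₗ[ℝ] Module.Dual ℝ (TangentSpace (𝓡 d) x) :=
  (w.flat x).linearEquivOfInjective (w.flat_injective x) Subspace.dual_finrank_eq.symm

/-- The Poisson bracket `{f, g}_ω = G_ω(df ∧ dg)`, that is `dg` applied to `G_ω(df)`. -/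
def poisson (f g : M → ℝ) (x : M) : ℝ :=
  mvfderiv (𝓡 d) g x ((w.flatEquiv x).symm (mvfderiv (𝓡 d) f x).toLinearMap)

end SymplecticForm
end Symplectic

/-- A Poisson bracket on a commutative `ℝ`-algebra. -/
structure PoissonBracket (A : Type u) [CommRing A] [Algebra ℝ A] where
  bracket : A →ₗ[ℝ] A →ₗ[ℝ] A
  self : ∀ f, bracket f f = 0
  jacobi : ∀ f g h, bracket f (bracket g h) + bracket g (bracket h f) + bracket h (bracket f g) = 0
  leibniz : ∀ f g h, bracket f (g * h) = bracket f g * h + g * bracket f h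

/-- A stratified symplectic form: a symplectic form on every stratum. -/
abbrev StratifiedSymplecticForm {X : Type u} [TopologicalSpace X] (D : Decomposition X) : Type u :=
  ∀ i, SymplecticForm (d := D.dim i) (D.stratum i)

/-- The smooth structure `F` is Poisson with respect to `σ`: there is a Poisson bracket on
`C^∞(X)` that restricts to the Poisson bracket of `σ_i` on every stratum `S_i`. -/
def IsPoisson {X : Type u} [TopologicalSpace X] {D : Decomposition X} (F : CInfSheaf X)
    (σ : StratifiedSymplecticForm D) : Prop :=
  ∃ P : PoissonBracket F.global, ∀ (f g : F.global) (i : D.Idx) (x : D.stratum i),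
    (P.bracket f g : X → ℝ) x =
      (σ i).poisson (fun y : D.stratum i => (f : X → ℝ) y) (fun y => (g : X → ℝ) y) x

/-- The 2-form `w ∈ Ω²(X)` is smooth and restricts to `σ_i` on every stratum `S_i`. The smooth
structure is compatible with `σ` if such a `w` exists. -/
def IsCompatible {X : Type u} [TopologicalSpace X] {D : Decomposition X} {F : CInfSheaf X}
    (hF : IsSmoothStructure D F) (σ : StratifiedSymplecticForm D) (w : F.Sections) : Prop :=
  w ∈ F.Forms 2 ∧ ∀ (i : D.Idx) (x : D.stratum i) (u v : TangentSpace (𝓡 (D.dim i)) x),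
    evalTwo (w x) (toZariski hF x u) (toZariski hF x v) = (σ i).form x ![u, v]

end StratifiedSymplectic

end

open StratifiedSymplectic

/-! Compatibility and the Poisson condition together force `X` to be a single stratum, so that the
statement becomes the Lefschetz decomposition on a symplectic manifold. Contracting `w` with the
inverse of the symplectic form of a stratum `S` gives `-dim S / 2`. If `w = ∑ f₀ df₁ ∧ df₂` near a
point, this contraction is `∑ f₀ {f₁, f₂}`, which is continuous because the brackets lie in
`C^∞(X)`. Hence the dimension of the strata is locally constant (`IsCompatible.eventually_dim_eq`).
A point with nonempty link is a limit of points in strata of larger dimension, so all links are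
empty and all strata are open. As `X^reg` is connected, there is only one stratum, of dimension
`2n`.

Once the link is empty, Hadamard's lemma shows that `T*_x X → T*_x S` is injective
(`cotangent_eq_zero`), so `w x` has an inverse bivector on `T*_x X` itself. Contraction with this
bivector preserves smooth forms, since it pairs `df` and `dg` to `{f, g}`. Up to sign it satisfies
the `sl₂` relations with `L` (`lefschetzRelations`).

The rest is formal. The relations and the vanishing of forms above degree `2n` make `L^k : Ω^{n-k} →
Ω^{n+k}` bijective (`eq_zero_of_raise_pow`, `exists_raise_pow_eq`). Surjectivity lets one split off
primitive parts, and injectivity makes the sums direct. -/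

/-! ### Abstract hard Lefschetz theorem and primitive decomposition. -/

/-- The `sl₂`-type relations between a raising operator `L` of degree 2 and a lowering operator `T`
of degree -2 on a family of subspaces `Ω m` that vanish for `m > 2n`. -/
structure LefschetzRelations {M : Type*} [AddCommGroup M] [Module ℝ M] (Ω : ℕ → Submodule ℝ M)
    (L T : Module.End ℝ M) (n : ℕ) : Prop where
  raise_mem : ∀ {m α}, α ∈ Ω m → L α ∈ Ω (m + 2)
  lower_mem : ∀ {m α}, α ∈ Ω (m + 2) → T α ∈ Ω m
  lower_zero : ∀ {α}, α ∈ Ω 0 → T α = 0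
  lower_one : ∀ {α}, α ∈ Ω 1 → T α = 0
  commutator : ∀ {m α}, α ∈ Ω m → T (L α) - L (T α) = ((n : ℝ) - m) • α
  eq_zero : ∀ {m α}, 2 * n < m → α ∈ Ω m → α = 0

namespace LefschetzRelations

variable {M : Type*} [AddCommGroup M] [Module ℝ M] {Ω : ℕ → Submodule ℝ M}
  {L T : Module.End ℝ M} {n : ℕ} (h : LefschetzRelations Ω L T n)

include h

theorem raise_pow_mem {m : ℕ} {α : M} (hα : α ∈ Ω m) (r : ℕ) : (L ^ r) α ∈ Ω (m + 2 * r) := by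
  induction r with
  | zero => simpa using hα
  | succ r ih =>
    rw [pow_succ', Module.End.mul_apply]
    exact h.raise_mem ih

theorem lower_pow_mem {m : ℕ} (r : ℕ) {α : M} (hα : α ∈ Ω (m + 2 * r)) : (T ^ r) α ∈ Ω m := by
  induction r generalizing m with
  | zero => simpa using hα
  | succ r ih =>
    rw [pow_succ', Module.End.mul_apply]
    exact h.lower_mem (ih (by convert hα using 2; ring))

/-- Moving `T` past one factor `L` at a time produces the constants `n - m - 2j` for `0 ≤ j ≤ r`,
whose sum is `(r + 1)(n - m - r)`. -/
theorem lower_raise_pow {m : ℕ} {α : M} (hα : α ∈ Ω m) (r : ℕ) :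
    T ((L ^ (r + 1)) α) =
      (L ^ (r + 1)) (T α) + (((r : ℝ) + 1) * (n - m - r)) • (L ^ r) α := by
  induction r with
  | zero =>
    have := h.commutator hα
    simp only [zero_add, pow_one, pow_zero, Module.End.one_apply]
    rw [sub_eq_iff_eq_add] at this
    rw [this, add_comm]
    simp
  | succ r ih =>
    have := h.commutator (h.raise_pow_mem hα (r + 1))
    rw [sub_eq_iff_eq_add] at this
    rw [pow_succ' L (r + 1), Module.End.mul_apply, this, ih, map_add, map_smul,
      Module.End.mul_apply, ← Module.End.mul_apply L (L ^ r), ← pow_succ', add_left_comm, ← add_smul]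
    congr 2
    push_cast
    ring

/-- The injectivity half of the hard Lefschetz theorem. -/
theorem eq_zero_of_raise_pow {m k : ℕ} (hmk : m + k = n) {α : M} (hα : α ∈ Ω m)
    (h0 : (L ^ k) α = 0) : α = 0 := by
  induction m using Nat.strong_induction_on generalizing k α with
  | _ m ih =>
    have hn : (n : ℝ) = m + k := by exact_mod_cast hmk.symm
    -- Applying `T` to `L^(k+1) α = 0` gives `L^(k+1) (T α) = 0`, hence `L^(k+2) (T α) = 0`. As `T
    -- α` has degree `m - 2` and `(m - 2) + (k + 2) = n`, induction applies.
    have hT : T α = 0 := by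
      have h1 := h.lower_raise_pow hα k
      have h2 : (L ^ (k + 1)) α = 0 := by
        rw [pow_succ', Module.End.mul_apply, h0, map_zero]
      rw [h2, h0, map_zero, smul_zero, add_zero] at h1
      rcases m with _ | _ | m
      · exact h.lower_zero hα
      · exact h.lower_one hα
      · refine ih m (by lia) (k := k + 2) (by lia) (h.lower_mem hα) ?_
        rw [pow_succ', Module.End.mul_apply, ← h1, map_zero]
    -- Since `T α = 0`, applying `T` to `L^(k-r) α` returns `(k - r)(r + 1) • L^(k-r-1) α`. This
    -- factor is positive for `r < k`, so the exponent descends to `0`.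
    have key : ∀ r ≤ k, (L ^ (k - r)) α = 0 := by
      intro r hr
      induction r with
      | zero => exact h0
      | succ r ihr =>
        have h1 := h.lower_raise_pow hα (k - (r + 1))
        have hk : k - (r + 1) + 1 = k - r := by lia
        rw [hk, ihr (by lia), hT, map_zero, map_zero, zero_add] at h1
        refine (smul_eq_zero.1 h1.symm).resolve_left ?_
        have hc : ((k - (r + 1) : ℕ) : ℝ) = k - (r + 1) := by
          rw [Nat.cast_sub hr]; push_cast; ring
        have hr' : (r : ℝ) + 1 ≤ k := by exact_mod_cast hr
        rw [hc, hn]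
        have : (0 : ℝ) ≤ r := r.cast_nonneg
        apply ne_of_gt
        apply mul_pos <;> linarith
    simpa using key k le_rfl

/-- The mirror image of `lower_raise_pow`, starting from a vector killed by `L`: the commutators
contribute `k - 2j` for `0 ≤ j ≤ r`. -/
theorem raise_lower_pow {m k : ℕ} (hmk : m + k = n) {β : M} (hβ : β ∈ Ω (n + k))
    (h0 : L β = 0) {r : ℕ} (hr : r + 1 ≤ k) :
    L ((T ^ (r + 1)) β) = (((r : ℝ) + 1) * (k - r)) • (T ^ r) β := by
  induction r with
  | zero =>
    have := h.commutator hβ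
    simp only [zero_add, pow_one, pow_zero, Module.End.one_apply]
    rw [h0, map_zero, zero_sub, neg_eq_iff_eq_neg, ← neg_smul] at this
    rw [this]
    congr 1
    push_cast
    ring
  | succ r ih =>
    have hmem : (T ^ (r + 1)) β ∈ Ω (n + k - 2 * (r + 1)) :=
      h.lower_pow_mem (r + 1) (by convert hβ using 2; lia)
    have := h.commutator hmem
    rw [ih (by lia), map_smul, ← Module.End.mul_apply, ← pow_succ', sub_eq_iff_eq_add,
      ← sub_eq_iff_eq_add', ← Module.End.mul_apply, ← sub_smul] at this
    rw [pow_succ' T (r + 1), ← Module.End.mul_apply L, Module.End.mul_apply,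
      Module.End.mul_apply, ← Module.End.mul_apply L, ← this]
    congr 1
    rw [Nat.cast_sub (by lia)]
    push_cast
    ring

/-- The surjectivity half of the hard Lefschetz theorem. -/
theorem exists_raise_pow_eq {m k : ℕ} (hmk : m + k = n) {β : M} (hβ : β ∈ Ω (n + k)) :
    ∃ α ∈ Ω m, (L ^ k) α = β := by
  induction m using Nat.strong_induction_on generalizing k β with
  | _ m ih =>
    -- If `L β = 0`, a multiple of `T^k β` is a preimage: `L^k T^k β` is `β` times the product of
    -- the factors `(r + 1)(k - r)`, all nonzero for `r < k`.
    have closed : ∀ β ∈ Ω (n + k), L β = 0 → ∃ α ∈ Ω m, (L ^ k) α = β := by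
      intro β hβ h0
      have key : ∀ r ≤ k, ∃ c : ℝ, c ≠ 0 ∧ (L ^ r) ((T ^ r) β) = c • β := by
        intro r hr
        induction r with
        | zero => exact ⟨1, one_ne_zero, by simp⟩
        | succ r ihr =>
          obtain ⟨c, hc, hc'⟩ := ihr (by lia)
          have hr' : (r : ℝ) + 1 ≤ k := by exact_mod_cast hr
          refine ⟨((r : ℝ) + 1) * (k - r) * c, ?_, ?_⟩
          · have : (0 : ℝ) ≤ r := r.cast_nonneg
            refine mul_ne_zero (ne_of_gt (mul_pos ?_ ?_)) hc <;> linarith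
          · rw [pow_succ L, Module.End.mul_apply, h.raise_lower_pow hmk hβ h0 hr, map_smul, hc',
              smul_smul]
      obtain ⟨c, hc, hc'⟩ := key k le_rfl
      refine ⟨c⁻¹ • (T ^ k) β, Submodule.smul_mem _ _ (h.lower_pow_mem k ?_), ?_⟩
      · convert hβ using 2; lia
      · rw [map_smul, hc', smul_smul, inv_mul_cancel₀ hc, one_smul]
    have top : ∀ {γ : M}, m < 2 → γ ∈ Ω (n + k) → L γ = 0 := fun hm hγ =>
      h.eq_zero (by lia) (h.raise_mem hγ)
    rcases lt_or_ge m 2 with hm | hm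
    · exact closed β hβ (top hm hβ)
    -- By induction `L β = L^(k+2) γ`. Then `β - L^(k+1) γ` is killed by `L`, which reduces to the
    -- case already treated.
    · obtain ⟨γ, hγ, hγ'⟩ := ih (m - 2) (by lia) (k := k + 2) (by lia) (β := L β)
        (h.raise_mem hβ)
      have hLγ : L γ ∈ Ω m := by
        have := h.raise_mem hγ
        rwa [Nat.sub_add_cancel hm] at this
      have hk : (L ^ k) (L γ) ∈ Ω (n + k) := by
        have := h.raise_pow_mem hLγ k
        convert this using 2; lia
      have hLk : L ((L ^ k) (L γ)) = L β := by
        rw [← hγ', ← Module.End.mul_apply, ← Module.End.mul_apply, ← pow_succ', ← pow_succ]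
      obtain ⟨α, hα, hα'⟩ := closed (β - (L ^ k) (L γ)) (Submodule.sub_mem _ hβ hk) (by
        rw [map_sub, hLk, sub_self])
      exact ⟨α + L γ, Submodule.add_mem _ hα hLγ, by rw [map_add, hα', sub_add_cancel]⟩

omit h in
theorem raise_pow_eq_zero_of_le {m s t : ℕ} {α : M} (hα : α ∈ Ω m ⊓ LinearMap.ker (L ^ s))
    (hst : s ≤ t) : (L ^ t) α = 0 := by
  rw [← Nat.sub_add_cancel hst, pow_add, Module.End.mul_apply, LinearMap.mem_ker.1 hα.2, map_zero]

/-- Surjectivity gives `L^(k+1) α = L^(k+2) β` with `β` in degree `m - 2`, so `α - L β` is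
primitive. For `m < 2` the subtraction `m - 2` truncates, but then `α` is primitive because `m + 2(k
+ 1) > 2n`. -/
theorem exists_primitive_add {m k : ℕ} (hmk : m + k = n) {α : M} (hα : α ∈ Ω m) :
    ∃ p ∈ Ω m ⊓ LinearMap.ker (L ^ (k + 1)), ∃ β, α = p + L β ∧
      (2 ≤ m → β ∈ Ω (m - 2)) ∧ (m < 2 → β = 0) := by
  rcases lt_or_ge m 2 with hm | hm
  · refine ⟨α, ⟨hα, ?_⟩, 0, by simp, by lia, fun _ => rfl⟩
    exact h.eq_zero (by lia) (h.raise_pow_mem hα (k + 1))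
  · have h1 : (L ^ (k + 1)) α ∈ Ω (n + (k + 2)) := by
      convert h.raise_pow_mem hα (k + 1) using 2; lia
    obtain ⟨β, hβ, hβ'⟩ := h.exists_raise_pow_eq (m := m - 2) (by lia) h1
    have hLβ : L β ∈ Ω m := by
      have := h.raise_mem hβ
      rwa [Nat.sub_add_cancel hm] at this
    refine ⟨α - L β, ⟨Submodule.sub_mem _ hα hLβ, ?_⟩, β, by simp, fun _ => hβ, by lia⟩
    change (L ^ (k + 1)) (α - L β) = 0
    rw [map_sub, ← hβ', ← Module.End.mul_apply, ← pow_succ, sub_self]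

theorem mem_iSup_primitive {k : ℕ} (hk : k ≤ n) {α : M} (hα : α ∈ Ω (n - k)) :
    α ∈ ⨆ r : {r : ℕ // k + 2 * r ≤ n},
      (Ω (n - (k + 2 * r)) ⊓ LinearMap.ker (L ^ (k + 2 * r + 1))).map (L ^ (r : ℕ)) := by
  obtain ⟨m, hm⟩ : ∃ m, m = n - k := ⟨_, rfl⟩
  induction m using Nat.strong_induction_on generalizing k α with
  | _ m ih =>
    obtain ⟨p, hp, β, rfl, hβ, hβ0⟩ := h.exists_primitive_add (m := n - k) (k := k) (by lia) hα
    refine Submodule.add_mem _ ?_ ?_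
    · refine Submodule.mem_iSup_of_mem ⟨0, by lia⟩ ?_
      simpa using hp
    · rcases lt_or_ge (n - k) 2 with hm2 | hm2
      · rw [hβ0 hm2, map_zero]
        exact Submodule.zero_mem _
      -- `L` carries the `r`-th summand for `k + 2` to the summand of index `r + 1` for `k`.
      · have h1 := ih (n - (k + 2)) (by lia) (k := k + 2) (by lia)
          (by simpa [Nat.sub_sub] using hβ hm2) rfl
        have h2 := Submodule.mem_map_of_mem (f := L) h1
        rw [Submodule.map_iSup] at h2
        refine SetLike.le_def.1 (iSup_le fun r => ?_) h2
        refine le_trans ?_ (le_iSup _ (⟨r + 1, by have := r.2; lia⟩ : {r : ℕ // k + 2 * r ≤ n}))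
        rw [← Submodule.map_comp, ← Module.End.mul_eq_comp, ← pow_succ']
        have e : k + 2 + 2 * (r : ℕ) = k + 2 * (r + 1) := by ring
        simp only [e, le_refl]

/-- Let `R` be the largest index with `p R ≠ 0`. Applying `L^(k+R)` kills the terms with `r < R`,
since `k + R + r ≥ k + 2r + 1`. What remains is `L^(k+2R) (p R) = 0`, against injectivity in degree
`n - (k + 2R)`. -/
theorem sum_primitive_eq_zero {k : ℕ} {s : Finset {r : ℕ // k + 2 * r ≤ n}}
    {p : {r : ℕ // k + 2 * r ≤ n} → M}
    (hp : ∀ r : {r : ℕ // k + 2 * r ≤ n}, p r ∈ Ω (n - (k + 2 * r)) ⊓ LinearMap.ker (L ^ (k + 2 * r + 1)))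
    (h0 : ∑ r ∈ s, (L ^ (r : ℕ)) (p r) = 0) : ∀ r ∈ s, p r = 0 := by
  classical
  by_contra hcon
  push Not at hcon
  obtain ⟨r₀, hr₀, hne₀⟩ := hcon
  obtain ⟨R, hR, hmax⟩ := (s.filter fun r => p r ≠ 0).exists_max_image (fun r => (r : ℕ))
    ⟨r₀, by simp [hr₀, hne₀]⟩
  simp only [Finset.mem_filter] at hR hmax
  apply hR.2
  have h1 := congr_arg (L ^ (k + (R : ℕ))) h0
  rw [map_sum, map_zero, Finset.sum_eq_single_of_mem R hR.1] at h1
  · rw [← Module.End.mul_apply, ← pow_add] at h1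
    refine h.eq_zero_of_raise_pow (k := k + 2 * R) (by have := R.2; lia) (hp R).1 ?_
    rwa [show k + 2 * (R : ℕ) = k + R + R by ring]
  · intro r hr hrR
    by_cases hz : p r = 0
    · rw [hz, map_zero, map_zero]
    · have hlt : (r : ℕ) < R :=
        lt_of_le_of_ne (hmax r ⟨hr, hz⟩) fun e => hrR (Subtype.ext e)
      rw [← Module.End.mul_apply, ← pow_add]
      exact raise_pow_eq_zero_of_le (hp r) (by lia)

theorem iSupIndep_primitive {k : ℕ} :
    iSupIndep fun r : {r : ℕ // k + 2 * r ≤ n} =>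
      (Ω (n - (k + 2 * r)) ⊓ LinearMap.ker (L ^ (k + 2 * r + 1))).map (L ^ (r : ℕ)) := by
  rw [iSupIndep_iff_finsetSum_eq_zero_imp_eq_zero]
  intro s v hv h0 r hr
  have hv' : ∀ r : {r : ℕ // k + 2 * r ≤ n}, ∃ p ∈ Ω (n - (k + 2 * r)) ⊓ LinearMap.ker (L ^ (k + 2 * r + 1)),
      r ∈ s → (L ^ (r : ℕ)) p = v r := by
    intro r
    by_cases hr : r ∈ s
    · obtain ⟨p, hp, hp'⟩ := hv r hr
      exact ⟨p, hp, fun _ => hp'⟩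
    · exact ⟨0, Submodule.zero_mem _, fun h => absurd h hr⟩
  choose p hp hpv using hv'
  rw [← hpv r hr, h.sum_primitive_eq_zero hp ?_ r hr, map_zero]
  rw [← h0]
  exact Finset.sum_congr rfl fun r hr => hpv r hr

theorem iSup_primitive {k : ℕ} (hk : k ≤ n) :
    ⨆ r : {r : ℕ // k + 2 * r ≤ n},
      (Ω (n - (k + 2 * r)) ⊓ LinearMap.ker (L ^ (k + 2 * r + 1))).map (L ^ (r : ℕ)) =
        Ω (n - k) := by
  refine le_antisymm (iSup_le fun r => ?_) fun α hα => h.mem_iSup_primitive hk hα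
  rintro _ ⟨p, hp, rfl⟩
  convert h.raise_pow_mem hp.1 r using 2
  have := r.2
  lia

theorem iSupIndep_primitive_add {k : ℕ} :
    iSupIndep fun r : {r : ℕ // k + 2 * r ≤ n} =>
      (Ω (n - (k + 2 * r)) ⊓ LinearMap.ker (L ^ (k + 2 * r + 1))).map (L ^ (k + (r : ℕ))) := by
  rw [iSupIndep_iff_finsetSum_eq_zero_imp_eq_zero]
  intro s v hv h0 r hr
  have hv' : ∀ r : {r : ℕ // k + 2 * r ≤ n}, ∃ p ∈ Ω (n - (k + 2 * r)) ⊓ LinearMap.ker (L ^ (k + 2 * r + 1)),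
      r ∈ s → (L ^ (k + (r : ℕ))) p = v r := by
    intro r
    by_cases hr : r ∈ s
    · obtain ⟨p, hp, hp'⟩ := hv r hr
      exact ⟨p, hp, fun _ => hp'⟩
    · exact ⟨0, Submodule.zero_mem _, fun h => absurd h hr⟩
  choose p hp hpv using hv'
  rw [← hpv r hr, h.sum_primitive_eq_zero hp ?_ r hr, map_zero]
  -- Injectivity of `L^k` on degree `n - k` brings the relation back to that degree. The bound `k ≤
  -- n` comes from the existence of the index `r`.
  refine h.eq_zero_of_raise_pow (m := n - k) (k := k) (by have := r.2; lia) ?_ ?_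
  · refine Submodule.sum_mem _ fun r _ => ?_
    convert h.raise_pow_mem (hp r).1 r using 2
    have := r.2
    lia
  · rw [map_sum, ← h0]
    refine Finset.sum_congr rfl fun r hr => ?_
    rw [← hpv r hr, pow_add, Module.End.mul_apply]

theorem iSup_primitive_add (k : ℕ) :
    ⨆ r : {r : ℕ // k + 2 * r ≤ n},
      (Ω (n - (k + 2 * r)) ⊓ LinearMap.ker (L ^ (k + 2 * r + 1))).map (L ^ (k + (r : ℕ))) =
        Ω (n + k) := by
  refine le_antisymm (iSup_le fun r => ?_) fun β hβ => ?_
  · rintro _ ⟨p, hp, rfl⟩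
    convert h.raise_pow_mem hp.1 (k + r) using 2
    have := r.2
    lia
  · rcases lt_or_ge n k with hk | hk
    · rw [h.eq_zero (by lia) hβ]
      exact Submodule.zero_mem _
    · obtain ⟨α, hα, rfl⟩ := h.exists_raise_pow_eq (Nat.sub_add_cancel hk) hβ
      have h1 := Submodule.mem_map_of_mem (f := L ^ k) (h.mem_iSup_primitive hk hα)
      simp_rw [Submodule.map_iSup, ← Submodule.map_comp, ← Module.End.mul_eq_comp, ← pow_add] at h1
      exact h1

end LefschetzRelations

/-! ### Contraction of exterior forms with a bivector. -/

section DualLefschetz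

open ExteriorAlgebra CliffordAlgebra

variable {R V : Type*} [CommRing R] [AddCommGroup V] [Module R V]

/-- `T` is the contraction of exterior forms with the bivector `s`. -/
structure IsBivectorContraction (s : V →ₗ[R] Module.Dual R V)
    (T : Module.End R (ExteriorAlgebra R V)) : Prop where
  map_one : T 1 = 0
  map_ι_mul : ∀ b a, T (ι R b * a) = ι R b * T a + contractLeft (Q := 0) (s b) a

theorem ExteriorAlgebra.linearMap_ext_ι_mul {N : Type*} [AddCommGroup N] [Module R N]
    {f g : ExteriorAlgebra R V →ₗ[R] N} (h1 : f 1 = g 1)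
    (h : ∀ b a, f a = g a → f (ι R b * a) = g (ι R b * a)) : f = g := by
  refine LinearMap.ext fun a => ?_
  induction a using CliffordAlgebra.left_induction with
  | algebraMap r => rw [Algebra.algebraMap_eq_smul_one, map_smul, map_smul, h1]
  | add x y hx hy => rw [map_add, map_add, hx, hy]
  | ι_mul x m hx => exact h m x hx

theorem ExteriorAlgebra.contractLeft_ι_mul' (d : Module.Dual R V) (b : V)
    (a : ExteriorAlgebra R V) :
    contractLeft (Q := 0) d (ι R b * a) = d b • a - ι R b * contractLeft (Q := 0) d a :=
  CliffordAlgebra.contractLeft_ι_mul d b a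

namespace IsBivectorContraction

variable {s : V →ₗ[R] Module.Dual R V} {T T' : Module.End R (ExteriorAlgebra R V)}

/-- The explicit formula for the contraction depends on how the 2-form is written as a sum.
Uniqueness allows any local expression to be used for the same operator. -/
theorem unique (h : IsBivectorContraction s T) (h' : IsBivectorContraction s T') : T = T' :=
  ExteriorAlgebra.linearMap_ext_ι_mul (h.map_one.trans h'.map_one.symm) fun b a hab => by
    rw [h.map_ι_mul, h'.map_ι_mul, hab]

theorem map_ι (h : IsBivectorContraction s T) (b : V) : T (ι R b) = 0 := by
  have := h.map_ι_mul b 1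
  rwa [mul_one, h.map_one, mul_zero, zero_add, contractLeft_one] at this

theorem map_ι_mul_ι_mul (h : IsBivectorContraction s T) (u v : V) (a : ExteriorAlgebra R V) :
    T (ι R u * (ι R v * a)) = ι R u * (ι R v * T a) + s u v • a +
      (ι R u * contractLeft (Q := 0) (s v) a - ι R v * contractLeft (Q := 0) (s u) a) := by
  rw [h.map_ι_mul, h.map_ι_mul, ExteriorAlgebra.contractLeft_ι_mul', mul_add]
  abel

end IsBivectorContraction

variable {N : Type*} [Fintype N] (c : N → R) (u : N → Fin 2 → V) (s : V →ₗ[R] Module.Dual R V)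

/-- If the bivector `s` is inverse to the 2-form `∑ c • u 0 ∧ u 1`, then the contraction with `s` is
`∑ c • i_{s (u 0)} i_{s (u 1)}`. -/
theorem isBivectorContraction_sum
    (hs : ∀ b, b = ∑ a, c a • (s (u a 1) b • u a 0 - s (u a 0) b • u a 1)) :
    IsBivectorContraction s
      (∑ a, c a • (contractLeft (Q := 0) (s (u a 0)) * contractLeft (Q := 0) (s (u a 1)) :
        Module.End R (ExteriorAlgebra R V))) where
  map_one := by
    simp [LinearMap.sum_apply, contractLeft_one]
  map_ι_mul b a := by
    -- Expanding `b` by `hs` turns contraction with `s b` into the cross terms left by moving the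
    -- two contractions past `ι b`.
    have h2 : contractLeft (Q := 0) (s b) a = ∑ i, c i • (s (u i 1) b •
        contractLeft (Q := 0) (s (u i 0)) a - s (u i 0) b • contractLeft (Q := 0) (s (u i 1)) a) := by
      conv_lhs => rw [hs b]
      simp [map_sum, LinearMap.sum_apply]
    rw [h2]
    simp only [LinearMap.sum_apply, LinearMap.smul_apply, Module.End.mul_apply, Finset.mul_sum,
      ← Finset.sum_add_distrib, ExteriorAlgebra.contractLeft_ι_mul', map_sub, map_smul,
      mul_smul_comm, ← smul_add]
    refine Finset.sum_congr rfl fun i _ => ?_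
    congr 1
    abel

/-- The operator on the left is a derivation of the exterior algebra. By `hs` it is the identity on
`V`, hence multiplication by the degree. -/
theorem sum_mul_contractLeft_ιMulti
    (hs : ∀ b, b = ∑ a, c a • (s (u a 1) b • u a 0 - s (u a 0) b • u a 1)) (m : ℕ) (v : Fin m → V) :
    ∑ i, c i • (ι R (u i 0) * contractLeft (Q := 0) (s (u i 1)) (ιMulti R m v) -
      ι R (u i 1) * contractLeft (Q := 0) (s (u i 0)) (ιMulti R m v)) = (m : R) • ιMulti R m v := by
  induction m with
  | zero => simp [contractLeft_one]
  | succ m ih =>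
    have hv : ι R (v 0) =
        ∑ a, c a • (s (u a 1) (v 0) • ι R (u a 0) - s (u a 0) (v 0) • ι R (u a 1)) := by
      conv_lhs => rw [hs (v 0)]
      simp [map_sum]
    have anti : ∀ x y : V, ∀ a, ι R x * (ι R y * a) = - (ι R y * (ι R x * a)) := by
      intro x y a
      rw [← mul_assoc, ← mul_assoc, ← neg_mul, eq_neg_of_add_eq_zero_left (ι_add_mul_swap x y)]
    rw [ιMulti_succ_apply]
    set A := ιMulti R m (Matrix.vecTail v) with hA
    have e : ∀ i, c i • (ι R (u i 0) * contractLeft (Q := 0) (s (u i 1)) (ι R (v 0) * A) -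
        ι R (u i 1) * contractLeft (Q := 0) (s (u i 0)) (ι R (v 0) * A)) =
        c i • (s (u i 1) (v 0) • ι R (u i 0) - s (u i 0) (v 0) • ι R (u i 1)) * A +
        ι R (v 0) * (c i • (ι R (u i 0) * contractLeft (Q := 0) (s (u i 1)) A -
          ι R (u i 1) * contractLeft (Q := 0) (s (u i 0)) A)) := by
      intro i
      simp only [ExteriorAlgebra.contractLeft_ι_mul', mul_sub, anti (u i 0) (v 0),
        anti (u i 1) (v 0), mul_smul_comm, smul_mul_assoc, sub_mul, ← smul_add]
      congr 1
      abel
    rw [Finset.sum_congr rfl fun i _ => e i, Finset.sum_add_distrib, ← Finset.sum_mul, ← hv,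
      ← Finset.mul_sum, ih, mul_smul_comm]
    push_cast
    rw [add_smul, one_smul, add_comm]

/-- The commutator of the wedge product with a 2-form and the contraction with the inverse
bivector. -/
theorem IsBivectorContraction.commutator {s} {T : Module.End R (ExteriorAlgebra R V)}
    (h : IsBivectorContraction s T)
    (hs : ∀ b, b = ∑ a, c a • (s (u a 1) b • u a 0 - s (u a 0) b • u a 1)) {t : R}
    (ht : ∑ a, c a * s (u a 0) (u a 1) = t) (m : ℕ) (v : Fin m → V) :
    T ((∑ a, c a • ιMulti R 2 (u a)) * ιMulti R m v) -
      (∑ a, c a • ιMulti R 2 (u a)) * T (ιMulti R m v) = (t + m) • ιMulti R m v := by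
  have two : ∀ a x, ιMulti R 2 (u a) * x = ι R (u a 0) * (ι R (u a 1) * x) := by
    intro a x
    rw [ιMulti_succ_apply, ιMulti_succ_apply, ιMulti_zero_apply, mul_one, mul_assoc]
    rfl
  -- The scalar terms `s (u 0) (u 1)` add up to `t`; the mixed terms form the degree operator and
  -- give `m`.
  rw [add_smul, ← sum_mul_contractLeft_ιMulti c u s hs, ← ht]
  simp only [Finset.sum_mul, smul_mul_assoc, two, map_sum, map_smul, h.map_ι_mul_ι_mul,
    ← Finset.sum_sub_distrib, Finset.sum_smul, ← Finset.sum_add_distrib, mul_smul]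
  refine Finset.sum_congr rfl fun i _ => ?_
  rw [← smul_sub, ← smul_add]
  congr 1
  abel

theorem evalTwo_sum_ιMulti {V : Type*} [AddCommGroup V] [Module ℝ V] (c : N → ℝ)
    (u : N → Fin 2 → V) (ξ η : Module.Dual ℝ V) :
    evalTwo (∑ a, c a • ιMulti ℝ 2 (u a)) ξ η =
      ∑ a, c a * (ξ (u a 0) * η (u a 1) - ξ (u a 1) * η (u a 0)) := by
  have two : ∀ a, ιMulti ℝ 2 (u a) = ι ℝ (u a 0) * ι ℝ (u a 1) := by
    intro a
    rw [ιMulti_succ_apply, ιMulti_succ_apply, ιMulti_zero_apply, mul_one]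
    rfl
  simp only [evalTwo, map_sum, map_smul, two, smul_eq_mul]
  refine Finset.sum_congr rfl fun i _ => ?_
  congr 1
  have h1 : contractLeft (Q := 0) ξ (ι ℝ (u i 1)) = algebraMap ℝ _ (ξ (u i 1)) :=
    CliffordAlgebra.contractLeft_ι _ _ _
  have h2 : ∀ j, contractLeft (Q := 0) η (ι ℝ (u i j)) = algebraMap ℝ _ (η (u i j)) :=
    fun j => CliffordAlgebra.contractLeft_ι _ _ _
  rw [ExteriorAlgebra.contractLeft_ι_mul', h1, map_sub, map_smul, h2, ← Algebra.commutes,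
    ← Algebra.smul_def, map_smul, h2, map_sub, map_smul, map_smul,
    ExteriorAlgebra.algebraMap_leftInverse, ExteriorAlgebra.algebraMap_leftInverse]
  simp

theorem ιMulti_eq_zero_of_finrank_lt {K V : Type*} [Field K] [AddCommGroup V] [Module K V]
    [FiniteDimensional K V] {m : ℕ} (hm : Module.finrank K V < m) (v : Fin m → V) :
    ιMulti K m v = 0 := by
  refine AlternatingMap.map_linearDependent _ _ fun hv => ?_
  have := hv.fintype_card_le_finrank
  rw [Fintype.card_fin] at this
  lia

/-- Take the trace of the identity, written as a sum of operators of rank at most one; `b ↦ p b • u`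
has trace `p u`. -/
theorem finrank_eq_sum_of_eq_sum {K V : Type*} [Field K] [AddCommGroup V] [Module K V]
    [FiniteDimensional K V] (c : N → K) (p q : N → Module.Dual K V) (u v : N → V)
    (h : ∀ b, b = ∑ a, c a • (p a b • u a - q a b • v a)) :
    (Module.finrank K V : K) = ∑ a, c a * (p a (u a) - q a (v a)) := by
  have e : (LinearMap.id : V →ₗ[K] V) =
      ∑ a, c a • ((p a).smulRight (u a) - (q a).smulRight (v a)) := by
    ext b
    simpa [LinearMap.sum_apply] using h b
  rw [← LinearMap.trace_id, e]
  simp [LinearMap.trace_smulRight]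

end DualLefschetz

/-! ### Hadamard's lemma to second order. -/

section Hadamard

open MeasureTheory intervalIntegral

/-- Each differentiation of `h (t • y)` in `y` brings out a factor `t`. The weight `t ^ k` keeps the
derivative within the same family of integrals, as the induction on smoothness needs. -/
theorem hasFDerivAt_integral_pow_smul {E F : Type*} [NormedAddCommGroup E] [NormedSpace ℝ E]
    [FiniteDimensional ℝ E] [NormedAddCommGroup F] [NormedSpace ℝ F] [CompleteSpace F]
    {h : E → F} (hh : ContDiff ℝ 1 h) (k : ℕ) (x : E) :
    HasFDerivAt (fun y => ∫ t in (0 : ℝ)..1, t ^ k • h (t • y))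
      (∫ t in (0 : ℝ)..1, t ^ (k + 1) • fderiv ℝ h (t • x)) x := by
  have hc := hh.continuous
  have hc' := hh.continuous_fderiv one_ne_zero
  obtain ⟨C, hC⟩ := (isCompact_closedBall (0 : E) (‖x‖ + 1)).exists_bound_of_continuousOn
    hc'.continuousOn
  have hd : Differentiable ℝ h := hh.differentiable one_ne_zero
  refine hasFDerivAt_integral_of_dominated_of_fderiv_le (bound := fun _ => C)
    (F' := fun y t => t ^ (k + 1) • fderiv ℝ h (t • y))
    (Metric.ball_mem_nhds x one_pos) ?_ ?_ ?_ ?_ ?_ ?_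
  · exact Filter.Eventually.of_forall fun y =>
      Continuous.aestronglyMeasurable (by fun_prop)
  · exact Continuous.intervalIntegrable (by fun_prop) _ _
  · exact Continuous.aestronglyMeasurable (by fun_prop)
  · refine Filter.Eventually.of_forall fun t ht y hy => ?_
    rw [Set.uIoc_of_le zero_le_one] at ht
    have hy' : ‖y‖ ≤ ‖x‖ + 1 := by
      have := norm_le_norm_add_norm_sub' y x
      rw [mem_ball_iff_norm] at hy
      linarith
    have h1 : ‖fderiv ℝ h (t • y)‖ ≤ C := by
      apply hC
      rw [mem_closedBall_zero_iff, norm_smul, Real.norm_of_nonneg ht.1.le]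
      exact (mul_le_of_le_one_left (norm_nonneg _) ht.2).trans hy'
    rw [norm_smul, norm_pow, Real.norm_of_nonneg ht.1.le]
    exact (mul_le_of_le_one_left (norm_nonneg _) (pow_le_one₀ ht.1.le ht.2)).trans h1
  · exact intervalIntegrable_const
  · refine Filter.Eventually.of_forall fun t _ y _ => ?_
    have h1 : HasFDerivAt (fun z : E => t • z) (t • ContinuousLinearMap.id ℝ E) y :=
      (hasFDerivAt_id y).const_smul t
    have h2 := ((hd (t • y)).hasFDerivAt.comp y h1).const_smul (t ^ k)
    convert h2 using 1
    · rfl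
    · rw [pow_succ, mul_smul, ContinuousLinearMap.comp_smul, ContinuousLinearMap.comp_id]

theorem contDiff_integral_pow_smul {E F : Type u} [NormedAddCommGroup E] [NormedSpace ℝ E]
    [FiniteDimensional ℝ E] [NormedAddCommGroup F] [NormedSpace ℝ F] [CompleteSpace F]
    {h : E → F} (n : ℕ) (hh : ContDiff ℝ (n + 1) h) (k : ℕ) :
    ContDiff ℝ n (fun y => ∫ t in (0 : ℝ)..1, t ^ k • h (t • y)) := by
  induction n generalizing F k with
  | zero =>
    have : Differentiable ℝ (fun y => ∫ t in (0 : ℝ)..1, t ^ k • h (t • y)) := fun y =>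
      (hasFDerivAt_integral_pow_smul (by simpa using hh) k y).differentiableAt
    exact contDiff_zero.2 this.continuous
  | succ n ih =>
    have hd := fun y => hasFDerivAt_integral_pow_smul (hh.of_le le_add_self) k y
    push_cast at hh ⊢
    rw [contDiff_succ_iff_fderiv]
    refine ⟨fun y => (hd y).differentiableAt, by simp, ?_⟩
    have e : fderiv ℝ (fun y => ∫ t in (0 : ℝ)..1, t ^ k • h (t • y)) =
        fun y => ∫ t in (0 : ℝ)..1, t ^ (k + 1) • fderiv ℝ h (t • y) := by
      ext1 y
      exact (hd y).fderiv
    rw [e]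
    exact ih (hh.fderiv_right (m := n + 1) (by rfl)) (k + 1)

/-- A function that is smooth near a point of a finite-dimensional space agrees near that point with
a globally smooth function. -/
theorem exists_contDiff_eventuallyEq {E : Type*} [NormedAddCommGroup E] [NormedSpace ℝ E]
    [FiniteDimensional ℝ E] {x : E} {f : E → ℝ} (hf : ∀ᶠ y in 𝓝 x, ContDiffAt ℝ ∞ f y) :
    ∃ h : E → ℝ, ContDiff ℝ ∞ h ∧ h =ᶠ[𝓝 x] f := by
  obtain ⟨r, hr, hball⟩ := Metric.eventually_nhds_iff_ball.1 hf
  let φ : ContDiffBump x := ⟨r / 4, r / 2, by positivity, by linarith⟩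
  refine ⟨fun y => φ y * f y, contDiff_iff_contDiffAt.2 fun y => ?_, ?_⟩
  · by_cases hy : y ∈ Metric.ball x r
    · exact φ.contDiff.contDiffAt.mul (hball y hy)
    · have hy' : y ∉ tsupport φ := by
        rw [φ.tsupport_eq]
        intro h
        apply hy
        rw [Metric.mem_closedBall] at h
        rw [Metric.mem_ball]
        have : φ.rOut = r / 2 := rfl
        linarith
      have : (fun y => φ y * f y) =ᶠ[𝓝 y] fun _ => 0 := by
        filter_upwards [notMem_tsupport_iff_eventuallyEq.1 hy'] with z hz
        simp [hz]
      exact contDiffAt_const.congr_of_eventuallyEq this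
  · filter_upwards [φ.eventuallyEq_one] with y hy
    simp [hy]

/-- Hadamard's lemma for a function with vanishing 1-jet. -/
theorem exists_eventually_eq_sum_mul {d : ℕ} {f : EuclideanSpace ℝ (Fin d) → ℝ}
    (hf : ∀ᶠ y in 𝓝 0, ContDiffAt ℝ ∞ f y) (h0 : f 0 = 0) (h0' : fderiv ℝ f 0 = 0) :
    ∃ g : Fin d → EuclideanSpace ℝ (Fin d) → ℝ, (∀ i, ContDiff ℝ ∞ (g i)) ∧ (∀ i, g i 0 = 0) ∧
      ∀ᶠ y in 𝓝 0, f y = ∑ i, y i * g i y := by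
  obtain ⟨h, hh, hhf⟩ := exists_contDiff_eventuallyEq hf
  have hfd : ContDiff ℝ ∞ (fderiv ℝ h) := hh.fderiv_right (by simp)
  -- The fundamental theorem of calculus on the segment from `0` to `y` gives `h y - h 0 = G y y`;
  -- the components of `G` are the required functions, and `G 0` is the derivative at `0`.
  let G : EuclideanSpace ℝ (Fin d) → EuclideanSpace ℝ (Fin d) →L[ℝ] ℝ :=
    fun y => ∫ t in (0 : ℝ)..1, fderiv ℝ h (t • y)
  have hG : ContDiff ℝ ∞ G := by
    rw [contDiff_infty]
    intro n
    simpa using contDiff_integral_pow_smul n (hfd.of_le (by exact_mod_cast le_top)) 0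
  refine ⟨fun i y => G y (EuclideanSpace.single i 1), fun i => by fun_prop, fun i => ?_, ?_⟩
  · have : G 0 = 0 := by simp [G, hhf.fderiv_eq, h0']
    simp [this]
  · filter_upwards [hhf] with y hy
    have h1 : h y - h 0 = G y y := by
      have hd : ∀ t ∈ Set.uIcc (0 : ℝ) 1,
          HasDerivAt (fun t : ℝ => h (t • y)) (fderiv ℝ h (t • y) y) t := by
        intro t _
        have e1 : HasDerivAt (fun t : ℝ => t • y) y t := by
          simpa using (hasDerivAt_id t).smul_const y
        exact ((hh.differentiable (by simp)) (t • y)).hasFDerivAt.comp_hasDerivAt t e1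
      have hc : Continuous fun t : ℝ => fderiv ℝ h (t • y) :=
        hfd.continuous.comp (by fun_prop)
      have h2 := integral_eq_sub_of_hasDerivAt hd
        (Continuous.intervalIntegrable (by fun_prop) _ _)
      simp only [one_smul, zero_smul] at h2
      rw [← h2, ContinuousLinearMap.intervalIntegral_apply (hc.intervalIntegrable _ _)]
    rw [hhf.self_of_nhds, h0, sub_zero] at h1
    rw [← hy, h1]
    have hy2 : y = ∑ i, y i • EuclideanSpace.single i (1 : ℝ) := by
      ext j
      simp [Pi.single_apply]
    exact (congr_arg (G y) hy2).trans (by simp only [map_sum, map_smul, smul_eq_mul])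

end Hadamard

namespace StratifiedSymplectic

/-! ### Links, dimensions and openness of strata. -/

section Strata

variable {X : Type u} [TopologicalSpace X] (D : Decomposition X)

/-- The frontier condition for `j = i` has a true right-hand side, which excludes empty strata. -/
theorem Decomposition.stratum_nonempty (i : D.Idx) : (D.stratum i).Nonempty :=
  ((D.frontier_iff i i).2 subset_closure).mono Set.inter_subset_left

theorem Decomposition.exists_mem_stratum (x : X) : ∃ i, x ∈ D.stratum i := by
  have : x ∈ ⋃ i, D.stratum i := by rw [D.cover]; trivial
  simpa using this

/-- The distance to the vertex. -/
noncomputable def Cone.radius {L : Type u} : Cone L → ℝ :=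
  Quot.lift (Sum.elim (fun _ => 0) fun p => (p.2 : ℝ)) (by rintro _ _ ⟨l⟩; rfl)

theorem Cone.incl_ne_vertex {L : Type u} (p : L × openInterval) :
    Cone.incl L p ≠ Cone.vertex L := fun h => by
  have h1 : (p.2 : ℝ) = 0 := congr_arg Cone.radius h
  exact p.2.2.1.ne' h1

theorem Cone.eq_vertex {L : Type u} [IsEmpty L] (p : Cone L) : p = Cone.vertex L := by
  induction p using Quot.ind with
  | mk a =>
    rcases a with a | a
    · rfl
    · exact isEmptyElim a.1

theorem Cone.exists_incl_mem {L : Type u} [TopologicalSpace L] (l : L) {W : Set (Cone L)}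
    (hW : W ∈ 𝓝 (Cone.vertex L)) : ∃ t, Cone.incl L (l, t) ∈ W := by
  let q : Set.Ico (0 : ℝ) 1 → Cone L := fun t => Quot.mk _ (Sum.inr (l, t))
  have hq : Continuous q := continuous_quot_mk.comp (by fun_prop)
  let z : Set.Ico (0 : ℝ) 1 := ⟨0, by simp⟩
  have hz : q z = Cone.vertex L := Quot.sound (ConeRel.glue l)
  have h1 : q ⁻¹' W ∈ 𝓝 z := hq.continuousAt (by rwa [hz])
  obtain ⟨ε, hε, hball⟩ := Metric.mem_nhds_iff.1 h1
  have hpos : 0 < min (ε / 2) (1 / 2) := by positivity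
  have h12 : min (ε / 2) (1 / 2) < 1 := (min_le_right _ _).trans_lt (by norm_num)
  refine ⟨⟨min (ε / 2) (1 / 2), hpos, h12⟩, ?_⟩
  refine hball (show (⟨min (ε / 2) (1 / 2), hpos.le, h12⟩ : Set.Ico (0 : ℝ) 1) ∈ _ from ?_)
  rw [Metric.mem_ball, Subtype.dist_eq, Real.dist_eq, sub_zero, abs_of_pos hpos]
  exact (min_le_left _ _).trans_lt (by linarith)

namespace Decomposition.LocalTrivialization

variable {D} {i : D.Idx} {x : D.stratum i} {L : Type u} [TopologicalSpace L]
  {DL : Decomposition L} (T : D.LocalTrivialization i x L DL)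

include T

/-- Inside `U`, any other stratum is diffeomorphic to a product of the ball, a stratum of the link
and an interval; the interval makes the inequality strict. -/
theorem dim_lt {k : D.Idx} (hk : k ≠ i) (hne : (D.stratum k ∩ T.U).Nonempty) :
    D.dim i < D.dim k := by
  obtain ⟨j, Φ, -⟩ := T.other_stratum k hk hne
  obtain ⟨y, hy, hyU⟩ := hne
  let y' : D.part k T.U := ⟨⟨y, hy⟩, hyU⟩
  have e := ((Φ.isLocalDiffeomorph y').mfderivToContinuousLinearEquiv
    (by simp)).toLinearEquiv.finrank_eq
  change Module.finrank ℝ (EuclideanSpace ℝ (Fin (D.dim k))) =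
    Module.finrank ℝ (EuclideanSpace ℝ (Fin (D.dim i)) ×
      (EuclideanSpace ℝ (Fin (DL.dim j)) × ℝ)) at e
  simp only [finrank_euclideanSpace, Fintype.card_fin, Module.finrank_prod,
    Module.finrank_self] at e
  lia

/-- The ray over `l` in the cone tends to the vertex, and none of its other points lies on the
stratum of `x`, which is `B × {vertex}` in the trivialization. -/
theorem exists_mem_stratum_ne (l : L) {W : Set X} (hW : W ∈ 𝓝 (x : X)) :
    ∃ k ≠ i, (D.stratum k ∩ T.U ∩ W).Nonempty := by
  let γ : Cone L → X := fun p => T.toHomeo.symm (unitBall.center _, p)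
  have hγ : Continuous γ :=
    continuous_subtype_val.comp (T.toHomeo.symm.continuous.comp (by fun_prop))
  have hγx : γ (Cone.vertex L) = x := by
    simp only [γ, ← T.map_base, Homeomorph.symm_apply_apply]
  obtain ⟨t, ht⟩ := Cone.exists_incl_mem l (hγ.continuousAt (by rwa [hγx]) : γ ⁻¹' W ∈ 𝓝 _)
  obtain ⟨k, hk⟩ := D.exists_mem_stratum (γ (Cone.incl L (l, t)))
  refine ⟨k, ?_, _, ⟨hk, Subtype.coe_prop _⟩, ht⟩
  rintro rfl
  obtain ⟨Φ, hΦ⟩ := T.vertex_stratum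
  have h1 := hΦ ⟨⟨_, hk⟩, Subtype.coe_prop _⟩
  have h2 : T.toHomeo (T.toHomeo.symm (unitBall.center _, Cone.incl L (l, t))) = _ := h1
  rw [Homeomorph.apply_symm_apply] at h2
  exact Cone.incl_ne_vertex _ (congr_arg Prod.snd h2)

/-- If the dimension of the strata is constant near `x`, then the link of `x` is empty. -/
theorem isEmpty_link (h : ∀ᶠ y in 𝓝 (x : X), ∀ k, y ∈ D.stratum k → D.dim k = D.dim i) :
    IsEmpty L := by
  by_contra hL
  rw [not_isEmpty_iff] at hL
  obtain ⟨k, hk, y, ⟨hyk, hyU⟩, hyW⟩ := T.exists_mem_stratum_ne (Classical.arbitrary L) h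
  exact (T.dim_lt hk ⟨y, hyk, hyU⟩).ne' (hyW k hyk)

theorem subset_stratum [IsEmpty L] : (T.U : Set X) ⊆ D.stratum i := by
  intro y hy
  obtain ⟨k, hk⟩ := D.exists_mem_stratum y
  by_cases hki : k = i
  · rwa [← hki]
  · obtain ⟨j, Φ, -⟩ := T.other_stratum k hki ⟨y, hk, hy⟩
    exact isEmptyElim ((Φ ⟨⟨y, hk⟩, hy⟩).2.1 : L)

end Decomposition.LocalTrivialization

/-- If all strata are open, then `X^reg = X` is connected and each stratum is clopen, its complement
being a union of strata. -/
theorem Decomposition.eq_of_isOpen (h : ∀ i, IsOpen (D.stratum i)) (hreg : IsConnected D.regular)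
    (i j : D.Idx) : i = j := by
  have hu : D.regular = Set.univ := by
    simp [Decomposition.regular, h, D.cover]
  have : PreconnectedSpace X := ⟨hu ▸ hreg.isPreconnected⟩
  have hc : IsClosed (D.stratum i) := by
    have e : (D.stratum i)ᶜ = ⋃ k ∈ {k | k ≠ i}, D.stratum k := by
      ext y
      simp only [Set.mem_compl_iff, Set.mem_iUnion, Set.mem_ofPred_eq, exists_prop]
      refine ⟨fun hy => ?_, ?_⟩
      · obtain ⟨k, hk⟩ := D.exists_mem_stratum y
        exact ⟨k, fun e => hy (e ▸ hk), hk⟩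
      · rintro ⟨k, hki, hk⟩ hy
        exact (D.disjoint k i hki).le_bot ⟨hk, hy⟩
    rw [← isOpen_compl_iff, e]
    exact isOpen_biUnion fun k _ => h k
  have hi : D.stratum i = Set.univ :=
    IsClopen.eq_univ ⟨hc, h i⟩ (D.stratum_nonempty i)
  by_contra hij
  obtain ⟨y, hy⟩ := D.stratum_nonempty j
  exact (D.disjoint i j hij).le_bot ⟨hi ▸ trivial, hy⟩

end Strata

end StratifiedSymplectic

namespace StratifiedSymplectic

/-! ### The cotangent space at a point with empty link. -/

section Cotangent

variable {X : Type u} [TopologicalSpace X] {D : Decomposition X} {F : CInfSheaf X}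

/-- A left inverse of the inclusion of the unit ball. -/
noncomputable def unitBall.retract (d : ℕ) (y : EuclideanSpace ℝ (Fin d)) : unitBall d :=
  open Classical in if h : y ∈ Metric.ball 0 1 then ⟨y, h⟩ else unitBall.center d

theorem unitBall.coe_retract {d : ℕ} {y : EuclideanSpace ℝ (Fin d)} (h : y ∈ Metric.ball 0 1) :
    (unitBall.retract d y : EuclideanSpace ℝ (Fin d)) = y := by
  rw [unitBall.retract, dif_pos h]

theorem unitBall.retract_coe {d : ℕ} (y : unitBall d) : unitBall.retract d y = y :=
  Subtype.ext (unitBall.coe_retract y.2)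

theorem unitBall.contMDiffAt_retract {d : ℕ} {y : EuclideanSpace ℝ (Fin d)}
    (h : y ∈ Metric.ball 0 1) : ContMDiffAt (𝓡 d) (𝓡 d) ∞ (unitBall.retract d) y := by
  rw [← ContMDiffAt.subtypeVal_comp_iff]
  refine contMDiffAt_id.congr_of_eventuallyEq ?_
  filter_upwards [Metric.isOpen_ball.mem_nhds h] with z hz
  exact unitBall.coe_retract hz

namespace Decomposition.LocalTrivialization

variable {i : D.Idx} {x : D.stratum i} {L : Type u} [TopologicalSpace L]
  {DL : Decomposition L} (T : D.LocalTrivialization i x L DL)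

/-- The pull-back to `X` of a function on the base of a local trivialization, extended by zero. -/
noncomputable def pullback (G : EuclideanSpace ℝ (Fin (D.dim i)) → ℝ) (z : X) : ℝ :=
  open Classical in if h : z ∈ T.U then G (T.toHomeo ⟨z, h⟩).1 else 0

theorem pullback_apply (G : EuclideanSpace ℝ (Fin (D.dim i)) → ℝ) {z : X} (h : z ∈ T.U) :
    T.pullback G z = G (T.toHomeo ⟨z, h⟩).1 := dif_pos h

theorem pullback_base (G : EuclideanSpace ℝ (Fin (D.dim i)) → ℝ) : T.pullback G x = G 0 := by
  rw [pullback_apply T G T.mem, T.map_base]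
  rfl

variable {C : CInfSheaf (Cone L)}
  (compat : ∀ (y : T.U) (f : X → ℝ), F.SmoothAt y f ↔
    ((CInfSheaf.ofManifold (𝓡 (D.dim i)) (unitBall (D.dim i))).prod C).SmoothAt
      (T.toHomeo y) (fun q => f (T.toHomeo.symm q)))

include compat

theorem smoothAt_pullback {G : EuclideanSpace ℝ (Fin (D.dim i)) → ℝ} (hG : ContDiff ℝ ∞ G) :
    F.SmoothAt x (T.pullback G) := by
  refine (compat ⟨x, T.mem⟩ _).2 ?_
  have e : (fun q => T.pullback G (T.toHomeo.symm q)) = fun q => G q.1 := by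
    ext q
    rw [T.pullback_apply G (T.toHomeo.symm q).2]
    simp
  rw [e]
  refine CInfSheaf.ProdSmoothAt.fst (fun b : unitBall (D.dim i) => G b) ?_
  exact Filter.Eventually.of_forall fun y =>
    (hG.contMDiff.comp contMDiff_subtype_val).contMDiffAt

/-- The expression in a local trivialization of a function near `x` on the stratum of `x`. -/
theorem eventually_contDiffAt {f : X → ℝ} (hf : F.SmoothAt x f) :
    ∀ᶠ y in 𝓝 0, ContDiffAt ℝ ∞ (fun y => f (T.toHomeo.symm (unitBall.retract _ y,
      Cone.vertex L))) y := by
  have h1 := prodSmoothAt_slice ((compat ⟨x, T.mem⟩ f).1 hf)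
  have hx : T.toHomeo ⟨x, T.mem⟩ = (unitBall.center _, Cone.vertex L) := T.map_base
  rw [hx] at h1
  have h0 : (0 : EuclideanSpace ℝ (Fin (D.dim i))) ∈ Metric.ball 0 1 := by simp
  have hr0 : unitBall.retract (D.dim i) 0 = unitBall.center _ :=
    Subtype.ext (unitBall.coe_retract h0)
  have hc : Filter.Tendsto (unitBall.retract (D.dim i)) (𝓝 0) (𝓝 (unitBall.center _)) := by
    rw [← hr0]
    exact (unitBall.contMDiffAt_retract h0).continuousAt
  filter_upwards [hc.eventually h1, Metric.isOpen_ball.mem_nhds h0] with y hy hyb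
  exact (ContMDiffAt.comp y hy (unitBall.contMDiffAt_retract hyb)).contDiffAt

omit compat in
-- Chain rule: the function is `f` on the stratum composed with the inverse of the chart, which
-- sends `0` to `x`.
theorem fderiv_eq_zero {f : X → ℝ}
    (hf : MDifferentiableAt (𝓡 (D.dim i)) 𝓘(ℝ, ℝ) (fun y : D.stratum i => f y) x)
    (h0 : mfderiv (𝓡 (D.dim i)) 𝓘(ℝ, ℝ) (fun y : D.stratum i => f y) x = 0) :
    fderiv ℝ (fun y => f (T.toHomeo.symm (unitBall.retract _ y, Cone.vertex L))) 0 = 0 := by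
  obtain ⟨Φ, hΦ⟩ := T.vertex_stratum
  have hz : (0 : EuclideanSpace ℝ (Fin (D.dim i))) ∈ Metric.ball 0 1 := by simp
  have hr0 : unitBall.retract (D.dim i) 0 = unitBall.center _ :=
    Subtype.ext (unitBall.coe_retract hz)
  let q : EuclideanSpace ℝ (Fin (D.dim i)) → D.stratum i :=
    fun y => (Φ.symm (unitBall.retract _ y) : D.part i T.U)
  have hq0 : q 0 = x := by
    have h1 : Φ ⟨x, T.mem⟩ = unitBall.center _ := by
      have := hΦ ⟨x, T.mem⟩
      exact congr_arg Prod.fst (this.symm.trans T.map_base)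
    simp only [q, hr0, ← h1, Diffeomorph.symm_apply_apply]
  have hq : MDifferentiableAt (𝓡 (D.dim i)) (𝓡 (D.dim i)) q 0 :=
    ((contMDiff_subtype_val.comp Φ.symm.contMDiff_toFun).contMDiffAt.comp 0
      (unitBall.contMDiffAt_retract hz)).mdifferentiableAt (by simp)
  have e : (fun y => f (T.toHomeo.symm (unitBall.retract _ y, Cone.vertex L))) =
      (fun y : D.stratum i => f y) ∘ q := by
    ext y
    have h1 := hΦ (Φ.symm (unitBall.retract _ y))
    rw [Diffeomorph.apply_symm_apply] at h1
    rw [← h1, Homeomorph.symm_apply_apply]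
    rfl
  have hf' : MDifferentiableAt (𝓡 (D.dim i)) 𝓘(ℝ, ℝ) (fun y : D.stratum i => f y) (q 0) := by
    rwa [hq0]
  have h1 : mfderiv (𝓡 (D.dim i)) 𝓘(ℝ, ℝ) (fun y : D.stratum i => f y) (q 0) = 0 :=
    hq0.symm ▸ h0
  ext v
  rw [← mfderiv_eq_fderiv, e]
  exact (DFunLike.congr_fun (mfderiv_comp 0 hf' hq) v).trans (DFunLike.congr_fun h1 _)

/-- If the link of `x` is empty, then a cotangent vector at `x` that vanishes on the stratum of `x`
is zero. -/
theorem cotangent_eq_zero [IsEmpty L] (hF : IsSmoothStructure D F) {ξ : F.Cotangent (x : X)}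
    (hξ : ∀ v, toZariski hF x v ξ = 0) : ξ = 0 := by
  obtain ⟨a, rfl⟩ := Ideal.toCotangent_surjective _ ξ
  obtain ⟨f, hf⟩ : ∃ f, F.germ (x : X) f = a := Ideal.Quotient.mk_surjective (a : F.Stalk (x : X))
  have hfx : (f : X → ℝ) x = 0 := by
    have h1 : F.evalAt x (a : F.Stalk (x : X)) = 0 := a.2
    rwa [← hf, CInfSheaf.evalAt_germ] at h1
  have hd : mfderiv (𝓡 (D.dim i)) 𝓘(ℝ, ℝ) (fun y : D.stratum i => (f : X → ℝ) y) x = 0 := by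
    ext v
    have h1 : derivGerm hF x v (a : F.Stalk (x : X)) = 0 := hξ v
    rw [← hf, derivGerm_germ] at h1
    exact h1
  have hmd : MDifferentiableAt (𝓡 (D.dim i)) 𝓘(ℝ, ℝ) (fun y : D.stratum i => (f : X → ℝ) y) x :=
    (hF.contMDiffAt x f.2).mdifferentiableAt (by simp)
  have hz : (0 : EuclideanSpace ℝ (Fin (D.dim i))) ∈ Metric.ball 0 1 := by simp
  have hr0 : unitBall.retract (D.dim i) 0 = unitBall.center _ :=
    Subtype.ext (unitBall.coe_retract hz)
  -- Both the value and the derivative of `f` along the stratum vanish at `x`, so Hadamard's lemma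
  -- writes `f` as `∑ y_j g_j` with `g_j 0 = 0`. The pull-backs of both factors lie in `𝔪_x`, so the
  -- germ of `f` lies in `𝔪_x²`.
  obtain ⟨g, hg, hg0, hfg⟩ := exists_eventually_eq_sum_mul (T.eventually_contDiffAt compat f.2)
    (by rw [hr0, ← T.map_base, Homeomorph.symm_apply_apply, hfx]) (T.fderiv_eq_zero hmd hd)
  let u (j : Fin (D.dim i)) : F.functionsAt (x : X) :=
    ⟨T.pullback fun y => y j, T.smoothAt_pullback compat (by fun_prop)⟩
  let v (j : Fin (D.dim i)) : F.functionsAt (x : X) :=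
    ⟨T.pullback (g j), T.smoothAt_pullback compat (hg j)⟩
  have hu (j) : F.germ x (u j) ∈ F.maxIdeal (x : X) := by
    change F.evalAt _ (F.germ _ (u j)) = 0
    rw [CInfSheaf.evalAt_germ]
    exact (T.pullback_base fun y => y j).trans rfl
  have hv (j) : F.germ x (v j) ∈ F.maxIdeal (x : X) := by
    change F.evalAt _ (F.germ _ (v j)) = 0
    rw [CInfSheaf.evalAt_germ]
    exact (T.pullback_base _).trans (hg0 j)
  have key : F.germ x f = ∑ j, F.germ x (u j) * F.germ x (v j) := by
    simp_rw [← map_mul, ← map_sum]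
    refine Ideal.Quotient.eq.2 ?_
    change ((f - ∑ j, u j * v j : F.functionsAt (x : X)) : X → ℝ) =ᶠ[𝓝 (x : X)] 0
    have hU : (T.U : Set X) ∈ 𝓝 (x : X) := T.U.2.mem_nhds T.mem
    let β : T.U → EuclideanSpace ℝ (Fin (D.dim i)) := fun z => (T.toHomeo z).1
    have hβ : Continuous β := by fun_prop
    have hβ0 : β ⟨x, T.mem⟩ = 0 := by
      simp only [β, T.map_base]
      rfl
    have h1 : ∀ᶠ z in 𝓝 (⟨x, T.mem⟩ : T.U), (f : X → ℝ) (T.toHomeo.symm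
        (unitBall.retract _ (β z), Cone.vertex L)) = ∑ j, β z j * g j (β z) :=
      (hβ.tendsto' _ _ hβ0).eventually hfg
    rw [nhds_subtype_eq_comap, Filter.eventually_comap] at h1
    filter_upwards [h1, hU] with z hz hzU
    have h2 := hz ⟨z, hzU⟩ rfl
    simp only [β, unitBall.retract_coe] at h2
    -- With empty link the cone is its vertex, so `f` on `U` is determined by its values on the
    -- stratum.
    rw [← Cone.eq_vertex (T.toHomeo ⟨z, hzU⟩).2, Prod.mk.eta, Homeomorph.symm_apply_apply] at h2
    have h3 : ((f - ∑ j, u j * v j : F.functionsAt (x : X)) : X → ℝ) z =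
        (f : X → ℝ) z - ∑ j, T.pullback (fun y => y j) z * T.pullback (g j) z := by
      simp [u, v, Finset.sum_apply]
    rw [h3, h2]
    simp [T.pullback_apply _ hzU]
  rw [Ideal.toCotangent_eq_zero, ← hf, key, pow_two]
  exact Ideal.sum_mem _ fun j _ => Ideal.mul_mem_mul (hu j) (hv j)

end Decomposition.LocalTrivialization

end Cotangent

/-! ### Linear algebra of a symplectic form and its inverse. -/

section LinearAlgebra

variable {T : Type*} [AddCommGroup T] [Module ℝ T] [FiniteDimensional ℝ T]
  (σ : T ≃ₗ[ℝ] Module.Dual ℝ T) (hσ : ∀ v w, σ v w = -σ w v)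
  {N : Type*} [Fintype N] (c : N → ℝ)

include hσ

/-- The contraction of a symplectic form with its inverse bivector. -/
theorem sum_symplectic_contraction (p q : N → Module.Dual ℝ T)
    (h : ∀ v w, σ v w = ∑ a, c a * (p a v * q a w - q a v * p a w)) :
    ∑ a, c a * q a (σ.symm (p a)) = -(Module.finrank ℝ T : ℝ) / 2 := by
  -- Applying `σ⁻¹` to the expansion of `σ v` decomposes the identity. Its trace is the dimension,
  -- and by antisymmetry each summand contributes twice, whence the factor `-1/2`.
  have h1 : ∀ v, v = ∑ a, c a • (p a v • σ.symm (q a) - q a v • σ.symm (p a)) := by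
    intro v
    apply σ.injective
    ext w
    simp [h v w, LinearMap.sum_apply]
  have h2 := finrank_eq_sum_of_eq_sum c p q _ _ h1
  have h3 : ∀ a, p a (σ.symm (q a)) = -q a (σ.symm (p a)) := by
    intro a
    have := hσ (σ.symm (p a)) (σ.symm (q a))
    simpa using this
  rw [h2]
  simp only [h3, neg_sub_left, mul_neg, ← two_mul]
  rw [Finset.sum_neg_distrib, neg_neg, Finset.sum_div]
  refine Finset.sum_congr rfl fun a _ => ?_
  ring

variable {V : Type*} [AddCommGroup V] [Module ℝ V] (ρ : V →ₗ[ℝ] Module.Dual ℝ T)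

omit [FiniteDimensional ℝ T] hσ in
/-- The bivector on `V` induced by the inverse of a symplectic form on `T`. -/
def inducedBivector : V →ₗ[ℝ] Module.Dual ℝ V := ρ.flip ∘ₗ σ.symm.toLinearMap ∘ₗ ρ

omit [FiniteDimensional ℝ T] hσ in
theorem inducedBivector_apply (a b : V) : inducedBivector σ ρ a b = ρ b (σ.symm (ρ a)) := rfl

omit [FiniteDimensional ℝ T] in
-- By injectivity it suffices to compare images under `ρ`. There the identity is the expansion of `σ
-- v` for `v = σ⁻¹ (ρ b)`, with signs from antisymmetry.
theorem eq_sum_inducedBivector (hρ : Function.Injective ρ) (u : N → Fin 2 → V)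
    (h : ∀ v w, σ v w = ∑ a, c a * (ρ (u a 0) v * ρ (u a 1) w - ρ (u a 1) v * ρ (u a 0) w))
    (b : V) : b = ∑ a, c a • (inducedBivector σ ρ (u a 1) b • u a 0 -
      inducedBivector σ ρ (u a 0) b • u a 1) := by
  apply hρ
  ext w
  have h1 := h (σ.symm (ρ b)) w
  rw [LinearEquiv.apply_symm_apply] at h1
  rw [h1]
  have h2 : ∀ a, ρ a (σ.symm (ρ b)) = -ρ b (σ.symm (ρ a)) := by
    intro a
    have := hσ (σ.symm (ρ a)) (σ.symm (ρ b))
    simp only [LinearEquiv.apply_symm_apply] at this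
    exact this
  simp only [h2, inducedBivector_apply, map_sum, map_smul, map_sub, LinearMap.sum_apply,
    LinearMap.smul_apply, LinearMap.sub_apply, smul_eq_mul]
  refine Finset.sum_congr rfl fun a _ => ?_
  ring

end LinearAlgebra

end StratifiedSymplectic

namespace StratifiedSymplectic

/-! ### Compatible Poisson structures have a single stratum. -/

section Compatible

variable {X : Type u} [TopologicalSpace X] {D : Decomposition X} {F : CInfSheaf X}
  {hF : IsSmoothStructure D F} {σ : StratifiedSymplecticForm D} {w : F.Sections}

theorem SymplecticForm.flatEquiv_apply {d : ℕ} {M : Type u} [TopologicalSpace M]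
    [ChartedSpace (EuclideanSpace ℝ (Fin d)) M] (τ : SymplecticForm (d := d) M) (x : M)
    (v u : TangentSpace (𝓡 d) x) : τ.flatEquiv x v u = τ.form x ![v, u] := rfl

theorem SymplecticForm.flatEquiv_swap {d : ℕ} {M : Type u} [TopologicalSpace M]
    [ChartedSpace (EuclideanSpace ℝ (Fin d)) M] (τ : SymplecticForm (d := d) M) (x : M)
    (v u : TangentSpace (𝓡 d) x) : τ.flatEquiv x v u = -τ.flatEquiv x u v := by
  rw [flatEquiv_apply, flatEquiv_apply]
  have h := (τ.form x).toAlternatingMap.map_swap ![u, v] (i := 0) (j := 1) (by simp)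
  have e : ![u, v] ∘ Equiv.swap (0 : Fin 2) 1 = ![v, u] := by
    ext i; fin_cases i <;> simp
  rw [e] at h
  exact h

theorem IsCompatible.flatEquiv_eq_sum (hw : IsCompatible hF σ w) {i : D.Idx} (x : D.stratum i)
    {N : ℕ} (c : Fin N → ℝ) (u : Fin N → Fin 2 → F.Cotangent (x : X))
    (hx : w x = ∑ a, c a • ExteriorAlgebra.ιMulti ℝ 2 (u a)) (v v' : TangentSpace (𝓡 (D.dim i)) x) :
    (σ i).flatEquiv x v v' =
      ∑ a, c a * ((toZariski hF x).flip (u a 0) v * (toZariski hF x).flip (u a 1) v' -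
        (toZariski hF x).flip (u a 1) v * (toZariski hF x).flip (u a 0) v') := by
  rw [SymplecticForm.flatEquiv_apply, ← hw.2, hx, evalTwo_sum_ιMulti]
  rfl

theorem toZariski_flip_d (i : D.Idx) (x : D.stratum i) (f : F.global) :
    (toZariski hF x).flip (F.d f x) =
      (mvfderiv (𝓡 (D.dim i)) (fun y : D.stratum i => (f : X → ℝ) y) x).toLinearMap := by
  ext v
  exact toZariski_differentialAt hF x v _

theorem finrank_tangentSpace {d : ℕ} {M : Type u} [TopologicalSpace M]
    [ChartedSpace (EuclideanSpace ℝ (Fin d)) M] (x : M) :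
    Module.finrank ℝ (TangentSpace (𝓡 d) x) = d :=
  finrank_euclideanSpace_fin

/-- The computation takes place in `T_x S` and does not need `T*_x X → T*_x S` to be injective. It
is thus available before links are known to be empty. -/
theorem IsCompatible.sum_inducedBivector (hw : IsCompatible hF σ w) {i : D.Idx}
    (x : D.stratum i) {N : ℕ} (c : Fin N → ℝ) (u : Fin N → Fin 2 → F.Cotangent (x : X))
    (hx : w x = ∑ a, c a • ExteriorAlgebra.ιMulti ℝ 2 (u a)) :
    ∑ a, c a * inducedBivector ((σ i).flatEquiv x) (toZariski hF x).flip (u a 0) (u a 1) =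
      -(D.dim i : ℝ) / 2 := by
  have h := sum_symplectic_contraction _ ((σ i).flatEquiv_swap x) c
    (fun a => (toZariski hF x).flip (u a 0)) (fun a => (toZariski hF x).flip (u a 1))
    (hw.flatEquiv_eq_sum x c u hx)
  rw [finrank_tangentSpace] at h
  exact h

/-- This is where the Poisson hypothesis enters: bivectors defined stratum by stratum pair
differentials to functions in `C^∞(X)`. -/
theorem inducedBivector_d {P : PoissonBracket F.global}
    (hP : ∀ (f g : F.global) (i : D.Idx) (x : D.stratum i), (P.bracket f g : X → ℝ) x =
      (σ i).poisson (fun y : D.stratum i => (f : X → ℝ) y) (fun y => (g : X → ℝ) y) x)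
    {i : D.Idx} (x : D.stratum i) (f g : F.global) :
    inducedBivector ((σ i).flatEquiv x) (toZariski hF x).flip (F.d f x) (F.d g x) =
      (P.bracket f g : X → ℝ) x := by
  rw [inducedBivector_apply, toZariski_flip_d, toZariski_flip_d, hP]
  rfl

/-- A compatible Poisson smooth structure forces the dimension of the strata to be locally
constant: it is the contraction of the 2-form with the Poisson bivector, up to a factor. -/
theorem IsCompatible.eventually_dim_eq (hw : IsCompatible hF σ w) (hP : IsPoisson F σ)
    {i : D.Idx} (x : D.stratum i) :
    ∀ᶠ y in 𝓝 (x : X), ∀ k, y ∈ D.stratum k → D.dim k = D.dim i := by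
  obtain ⟨P, hP⟩ := hP
  obtain ⟨U, hU, hxU, N, f₀, f, hf⟩ := hw.1 x
  -- The contraction of `w` with the Poisson bivector, using the expression of `w` on `U`.
  let ψ : F.global := ∑ a, f₀ a * P.bracket (f a 0) (f a 1)
  have hψ : ∀ y ∈ U, ∀ k, y ∈ D.stratum k → (ψ : X → ℝ) y = -(D.dim k : ℝ) / 2 := by
    intro y hy k hk
    rw [← hw.sum_inducedBivector ⟨y, hk⟩ _ _ (hf y hy)]
    simp only [inducedBivector_d hP ⟨y, hk⟩]
    simp [ψ, Finset.sum_apply]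
  have hc : ContinuousAt (ψ : X → ℝ) x := F.continuousAt (ψ.2 x)
  -- Values `-dim / 2` that differ by less than `1/2` come from equal integers.
  filter_upwards [hU.mem_nhds hxU, hc.eventually (Metric.ball_mem_nhds _ one_half_pos)]
    with y hy hd k hk
  change dist _ _ < _ at hd
  rw [hψ x hxU i x.2, hψ y hy k hk, Real.dist_eq, abs_lt] at hd
  have h1 : (D.dim k : ℝ) < D.dim i + 1 := by linarith
  have h2 : (D.dim i : ℝ) < D.dim k + 1 := by linarith
  norm_cast at h1 h2
  lia

theorem IsCompatible.toZariski_flip_injective (hw : IsCompatible hF σ w) (hP : IsPoisson F σ)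
    {i : D.Idx} (x : D.stratum i) : Function.Injective (toZariski hF x).flip := by
  have hF' := hF
  obtain ⟨_, _, _, L, DL, FL, C, _, _, _, T, compat⟩ := hF'
  have := (T i x).isEmpty_link (hw.eventually_dim_eq hP x)
  refine (injective_iff_map_eq_zero _).2 fun ξ hξ => ?_
  exact (T i x).cotangent_eq_zero (compat i x) hF fun v => DFunLike.congr_fun hξ v

theorem IsCompatible.isOpen_stratum (hw : IsCompatible hF σ w) (hP : IsPoisson F σ)
    (i : D.Idx) : IsOpen (D.stratum i) := by
  have hF' := hF
  obtain ⟨_, _, _, L, DL, FL, C, _, _, _, T, compat⟩ := hF'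
  refine isOpen_iff_mem_nhds.2 fun x hx => ?_
  have := (T i ⟨x, hx⟩).isEmpty_link (hw.eventually_dim_eq hP ⟨x, hx⟩)
  exact Filter.mem_of_superset ((T i ⟨x, hx⟩).U.2.mem_nhds (T i ⟨x, hx⟩).mem)
    (T i ⟨x, hx⟩).subset_stratum

theorem IsCompatible.dim_eq (hw : IsCompatible hF σ w) (hP : IsPoisson F σ)
    (hreg : IsConnected D.regular) {d : ℕ} (hd : D.HasDim d) (i : D.Idx) : D.dim i = d := by
  obtain ⟨j, rfl⟩ := hd.1
  rw [D.eq_of_isOpen (hw.isOpen_stratum hP) hreg i j]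

/-- `s` is the bivector at `x` that gives the Poisson bracket, and it is inverse to the 2-form
`w x`. -/
structure IsInverseBivector (w : F.Sections) (P : PoissonBracket F.global) (n : ℕ) (x : X)
    (s : F.Cotangent x →ₗ[ℝ] Module.Dual ℝ (F.Cotangent x)) : Prop where
  bracket : ∀ f g, s (F.d f x) (F.d g x) = (P.bracket f g : X → ℝ) x
  inverse : ∀ (N : ℕ) (c : Fin N → ℝ) (u : Fin N → Fin 2 → F.Cotangent x),
    w x = ∑ a, c a • ExteriorAlgebra.ιMulti ℝ 2 (u a) →
      ∀ b, b = ∑ a, c a • (s (u a 1) b • u a 0 - s (u a 0) b • u a 1)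
  contraction : ∀ (N : ℕ) (c : Fin N → ℝ) (u : Fin N → Fin 2 → F.Cotangent x),
    w x = ∑ a, c a • ExteriorAlgebra.ιMulti ℝ 2 (u a) → ∑ a, c a * s (u a 0) (u a 1) = -n

theorem IsCompatible.exists_isInverseBivector (hw : IsCompatible hF σ w)
    (hreg : IsConnected D.regular) {n : ℕ} (hn : D.HasDim (2 * n)) {P : PoissonBracket F.global}
    (hP : ∀ (f g : F.global) (i : D.Idx) (x : D.stratum i), (P.bracket f g : X → ℝ) x =
      (σ i).poisson (fun y : D.stratum i => (f : X → ℝ) y) (fun y => (g : X → ℝ) y) x) (x : X) :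
    ∃ s, IsInverseBivector w P n x s := by
  obtain ⟨i, hi⟩ := D.exists_mem_stratum x
  refine ⟨inducedBivector ((σ i).flatEquiv ⟨x, hi⟩) (toZariski hF ⟨x, hi⟩).flip,
    inducedBivector_d hP ⟨x, hi⟩, fun N c u hx => ?_, fun N c u hx => ?_⟩
  · exact eq_sum_inducedBivector _ ((σ i).flatEquiv_swap ⟨x, hi⟩) c _
      (hw.toZariski_flip_injective ⟨P, hP⟩ ⟨x, hi⟩) u (hw.flatEquiv_eq_sum ⟨x, hi⟩ c u hx)
  · rw [hw.sum_inducedBivector ⟨x, hi⟩ c u hx, hw.dim_eq ⟨P, hP⟩ hreg hn]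
    push_cast
    ring

/-- `T*_x X` embeds into the dual of the tangent space of the stratum, which has dimension `d`. -/
theorem IsCompatible.ιMulti_eq_zero (hw : IsCompatible hF σ w) (hP : IsPoisson F σ)
    (hreg : IsConnected D.regular) {d : ℕ} (hd : D.HasDim d) {m : ℕ} (hm : d < m) (x : X)
    (v : Fin m → F.Cotangent x) : ExteriorAlgebra.ιMulti ℝ m v = 0 := by
  obtain ⟨i, hi⟩ := D.exists_mem_stratum x
  have hinj := hw.toZariski_flip_injective hP ⟨x, hi⟩
  have : FiniteDimensional ℝ (F.Cotangent x) := Module.Finite.of_injective _ hinj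
  refine ιMulti_eq_zero_of_finrank_lt (lt_of_le_of_lt ?_ hm) v
  have h1 := LinearMap.finrank_le_finrank_of_injective hinj
  rwa [Subspace.dual_finrank_eq, finrank_tangentSpace, hw.dim_eq hP hreg hd] at h1

end Compatible

end StratifiedSymplectic

namespace StratifiedSymplectic

/-! ### The Lefschetz operators on smooth forms. -/

section SmoothForms

open ExteriorAlgebra CliffordAlgebra

variable {X : Type u} [TopologicalSpace X] {F : CInfSheaf X}

namespace CInfSheaf

theorem mem_forms_of_locally {k : ℕ} {α : F.Sections}
    (h : ∀ x, ∃ U : Set X, IsOpen U ∧ x ∈ U ∧ ∃ β ∈ F.Forms k, ∀ y ∈ U, α y = β y) :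
    α ∈ F.Forms k := by
  intro x
  obtain ⟨U, hU, hxU, β, hβ, hαβ⟩ := h x
  obtain ⟨V, hV, hxV, N, f₀, f, hf⟩ := hβ x
  exact ⟨U ∩ V, hU.inter hV, ⟨hxU, hxV⟩, N, f₀, f, fun y hy => (hαβ y hy.1).trans (hf y hy.2)⟩

theorem smul_mem_forms {k : ℕ} (g : F.global) {α : F.Sections} (hα : α ∈ F.Forms k) :
    (fun y => (g : X → ℝ) y • α y) ∈ F.Forms k := by
  intro x
  obtain ⟨U, hU, hxU, N, f₀, f, hf⟩ := hα x
  refine ⟨U, hU, hxU, N, fun a => g * f₀ a, f, fun y hy => ?_⟩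
  simp [hf y hy, Finset.smul_sum, smul_smul]

theorem ιMulti_mem_forms {k : ℕ} (f : Fin k → F.global) :
    (fun y => ιMulti ℝ k fun b => F.d (f b) y) ∈ F.Forms k := fun _ =>
  ⟨Set.univ, isOpen_univ, trivial, 1, fun _ => 1, fun _ => f, fun y _ => by simp⟩

/-- A field of linear maps preserves smoothness of forms if it does so for `df₁ ∧ … ∧ df_k`. -/
theorem map_mem_forms {k m : ℕ}
    (Φ : ∀ y, ExteriorAlgebra ℝ (F.Cotangent y) →ₗ[ℝ] ExteriorAlgebra ℝ (F.Cotangent y))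
    (hΦ : ∀ f : Fin k → F.global, (fun y => Φ y (ιMulti ℝ k fun b => F.d (f b) y)) ∈ F.Forms m)
    {α : F.Sections} (hα : α ∈ F.Forms k) : (fun y => Φ y (α y)) ∈ F.Forms m := by
  refine mem_forms_of_locally fun x => ?_
  obtain ⟨U, hU, hxU, N, f₀, f, hf⟩ := hα x
  refine ⟨U, hU, hxU, ∑ a, fun y => (f₀ a : X → ℝ) y • Φ y (ιMulti ℝ k fun b => F.d (f a b) y),
    Submodule.sum_mem _ fun a _ => smul_mem_forms _ (hΦ (f a)), fun y hy => ?_⟩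
  simp [hf y hy, map_sum, Finset.sum_apply]

theorem ι_mul_mem_forms {k : ℕ} (g : F.global) {α : F.Sections} (hα : α ∈ F.Forms k) :
    (fun y => ι ℝ (F.d g y) * α y) ∈ F.Forms (k + 1) := by
  refine map_mem_forms (fun y => LinearMap.mulLeft ℝ (ι ℝ (F.d g y))) (fun f => ?_) hα
  convert ιMulti_mem_forms (Fin.cons g f : Fin (k + 1) → F.global) using 2 with y
  rw [ιMulti_succ_apply]
  rfl

theorem L_mem_forms {w : F.Sections} (hw : w ∈ F.Forms 2) {k : ℕ} {α : F.Sections}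
    (hα : α ∈ F.Forms k) : F.L w α ∈ F.Forms (k + 2) := by
  refine mem_forms_of_locally fun x => ?_
  obtain ⟨U, hU, hxU, N, f₀, f, hf⟩ := hw x
  refine ⟨U, hU, hxU, ∑ a, fun y => (f₀ a : X → ℝ) y •
    (ι ℝ (F.d (f a 0) y) * (ι ℝ (F.d (f a 1) y) * α y)), Submodule.sum_mem _ fun a _ =>
      smul_mem_forms _ (ι_mul_mem_forms _ (ι_mul_mem_forms _ hα)), fun y hy => ?_⟩
  change w y * α y = _
  simp [hf y hy, Finset.sum_mul, Finset.sum_apply, ιMulti_succ_apply, mul_assoc, Matrix.vecTail]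

end CInfSheaf

variable {w : F.Sections} {P : PoissonBracket F.global} {n : ℕ}
  {s : ∀ x, F.Cotangent x →ₗ[ℝ] Module.Dual ℝ (F.Cotangent x)}
  (hs : ∀ x, IsInverseBivector w P n x (s x))

include hs

/-- Contracting `df₁ ∧ … ∧ df_k` with the Hamiltonian vector of `g` produces, by the antiderivation
rule, coefficients `{g, f_j}`, which are smooth. -/
theorem contractLeft_mem_forms {k : ℕ} (g : F.global) {α : F.Sections}
    (hα : α ∈ F.Forms (k + 1)) :
    (fun y => contractLeft (Q := 0) (s y (F.d g y)) (α y)) ∈ F.Forms k := by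
  refine CInfSheaf.map_mem_forms (fun y => contractLeft (Q := 0) (s y (F.d g y))) (fun f => ?_) hα
  clear hα
  induction k with
  | zero =>
    convert CInfSheaf.smul_mem_forms (P.bracket g (f 0))
      (CInfSheaf.ιMulti_mem_forms (F := F) (Fin.elim0 : Fin 0 → F.global)) using 2 with y
    rw [ιMulti_succ_apply, ExteriorAlgebra.contractLeft_ι_mul', (hs y).bracket, ιMulti_zero_apply,
      contractLeft_one, mul_zero, sub_zero, ιMulti_zero_apply]
  | succ k ih =>
    convert Submodule.sub_mem _ (CInfSheaf.smul_mem_forms (P.bracket g (f 0))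
      (CInfSheaf.ιMulti_mem_forms (Fin.tail f))) (CInfSheaf.ι_mul_mem_forms (f 0) (ih (Fin.tail f)))
      using 2 with y
    rw [ιMulti_succ_apply, ExteriorAlgebra.contractLeft_ι_mul', (hs y).bracket]
    rfl

variable {T : ∀ x, Module.End ℝ (ExteriorAlgebra ℝ (F.Cotangent x))}
  (hT : ∀ x, IsBivectorContraction (s x) (T x))

include hT

theorem bivectorContraction_mem_forms (hw : w ∈ F.Forms 2) {k : ℕ} {α : F.Sections}
    (hα : α ∈ F.Forms (k + 2)) : (fun y => T y (α y)) ∈ F.Forms k := by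
  refine CInfSheaf.mem_forms_of_locally fun x => ?_
  obtain ⟨U, hU, hxU, N, f₀, f, hf⟩ := hw x
  refine ⟨U, hU, hxU, ∑ a, fun y => (f₀ a : X → ℝ) y •
    contractLeft (Q := 0) (s y (F.d (f a 0) y)) (contractLeft (Q := 0) (s y (F.d (f a 1) y)) (α y)),
    Submodule.sum_mem _ fun a _ => CInfSheaf.smul_mem_forms _
      (contractLeft_mem_forms hs _ (contractLeft_mem_forms hs _ hα)), fun y hy => ?_⟩
  -- On all of `U` the operator is given by the one formula coming from the local expression of `w`.
  rw [(hT y).unique (isBivectorContraction_sum _ _ _ ((hs y).inverse _ _ _ (hf y hy)))]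
  simp [LinearMap.sum_apply, Finset.sum_apply]

theorem bivectorContraction_commutator (hw : w ∈ F.Forms 2) {m : ℕ} {α : F.Sections}
    (hα : α ∈ F.Forms m) (x : X) :
    T x (w x * α x) - w x * T x (α x) = (-(n : ℝ) + m) • α x := by
  obtain ⟨U, -, hxU, N, f₀, f, hf⟩ := hw x
  obtain ⟨V, -, hxV, M, g₀, g, hg⟩ := hα x
  have h1 := (hT x).commutator _ _ ((hs x).inverse _ _ _ (hf x hxU))
    ((hs x).contraction _ _ _ (hf x hxU)) m
  simp only [← hf x hxU] at h1
  rw [hg x hxV]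
  simp only [Finset.mul_sum, map_sum, mul_smul_comm, map_smul, Finset.smul_sum,
    ← Finset.sum_sub_distrib, ← smul_sub, h1]
  exact Finset.sum_congr rfl fun a _ => smul_comm _ _ _

/-- The contraction of `w` with the bivector is `-n`, so the commutator of `T` with `L` is `m - n`;
the minus sign before the lowering operator corrects this to `n - m`. -/
theorem lefschetzRelations (hw : w ∈ F.Forms 2)
    (h0 : ∀ m, 2 * n < m → ∀ x (v : Fin m → F.Cotangent x), ιMulti ℝ m v = 0) :
    LefschetzRelations F.Forms (F.L w)
      (-LinearMap.pi fun x => T x ∘ₗ LinearMap.proj x : Module.End ℝ F.Sections) n where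
  raise_mem := CInfSheaf.L_mem_forms hw
  lower_mem hα := Submodule.neg_mem _ (bivectorContraction_mem_forms hs hT hw hα)
  lower_zero {α} hα := by
    ext1 x
    obtain ⟨U, -, hxU, N, f₀, f, hf⟩ := hα x
    change -T x (α x) = 0
    simp [hf x hxU, map_sum, (hT x).map_one]
  lower_one {α} hα := by
    ext1 x
    obtain ⟨U, -, hxU, N, f₀, f, hf⟩ := hα x
    change -T x (α x) = 0
    simp [hf x hxU, map_sum, ιMulti_succ_apply, (hT x).map_ι]
  commutator {m α} hα := by
    ext1 x
    change -T x (w x * α x) - w x * -T x (α x) = ((n : ℝ) - m) • α x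
    rw [mul_neg, sub_neg_eq_add, neg_add_eq_sub, ← neg_sub,
      bivectorContraction_commutator hs hT hw hα x, ← neg_smul]
    congr 1
    ring
  eq_zero {m α} hm hα := by
    ext1 x
    obtain ⟨U, -, hxU, N, f₀, f, hf⟩ := hα x
    simp [hf x hxU, h0 m hm]

end SmoothForms

end StratifiedSymplectic

theorem proposition5p2 {X : Type u} [TopologicalSpace X] [T2Space X] [ParacompactSpace X]
    (D : Decomposition X) (hD : D.IsStratified) (hreg : IsConnected D.regular)
    (F : CInfSheaf X) (hF : IsSmoothStructure D F)
    (σ : StratifiedSymplecticForm D) (hP : IsPoisson F σ)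
    (w : F.Sections) (hw : IsCompatible hF σ w)
    (n : ℕ) (hn : D.HasDim (2 * n)) :
    (∀ k ≤ n,
      iSupIndep (fun r : {r : ℕ // k + 2 * r ≤ n} =>
        (F.Primitive w n (k + 2 * r)).map (F.L w ^ (r : ℕ))) ∧
      ⨆ r : {r : ℕ // k + 2 * r ≤ n},
        (F.Primitive w n (k + 2 * r)).map (F.L w ^ (r : ℕ)) = F.Forms (n - k)) ∧
    (∀ k : ℕ,
      iSupIndep (fun r : {r : ℕ // k + 2 * r ≤ n} =>
        (F.Primitive w n (k + 2 * r)).map (F.L w ^ (k + (r : ℕ)))) ∧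
      ⨆ r : {r : ℕ // k + 2 * r ≤ n},
        (F.Primitive w n (k + 2 * r)).map (F.L w ^ (k + (r : ℕ))) = F.Forms (n + k)) := by
  obtain ⟨P, hP'⟩ := id hP
  -- The bivectors and contractions are chosen point by point, with no regularity; smoothness comes
  -- from the bracket and from uniqueness of the contraction.
  choose s hs using hw.exists_isInverseBivector hreg hn hP'
  have hT : ∀ x, ∃ T, IsBivectorContraction (s x) T := fun x => by
    obtain ⟨U, -, hxU, N, f₀, f, hf⟩ := hw.1 x
    exact ⟨_, isBivectorContraction_sum _ _ _ ((hs x).inverse _ _ _ (hf x hxU))⟩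
  choose T hT using hT
  have h := lefschetzRelations hs hT hw.1 fun m hm => hw.ιMulti_eq_zero hP hreg hn hm
  exact ⟨fun k hk => ⟨h.iSupIndep_primitive, h.iSup_primitive hk⟩,
    fun k => ⟨h.iSupIndep_primitive_add, h.iSup_primitive_add k⟩⟩
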